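/- **Setting.** A *factor graph* $\mathsf G$ consists of finite sets $V$ (variable nodes, with binary variables) and $F$ (function nodes), an adjacency relation between them, and for each $f\in F$ a local function $f\ge 0$ of the variables in its neighbourhood $\partial f$, such that $g(x)=\sum_{f}f(x_{\partial f})\in[0,1]$ for all $x\in\{0,1\}^V$. Fix a boundary set $V_B\subseteq V$. Let $\mathsf G_1,\dots,\mathsf G_{N_G}$, $N_G\ge 1$, be the connected components of the graph obtained by deleting $V_B$ (with its edges) that contain at least one variable node; $V_n$ and $F_n$ are the variable and function nodes of $\mathsf G_n$, and $V_{B,n}\subseteq V_B$ is the set of boundary variables adjacent to a function node in $F_n$. Put $|\mathcal X_{S}|=2^{|S|}$ for $S\subseteq V$. For $x_{V_{B,n}}\in\{0,1\}^{V_{B,n}}$ let $g_{n,x_{V_{B,n}}}(x_{V_n})=\sum_{f\in F_n}f(x_{\partial f})$. *Leaf oracles.* For each $n$ and each $x_{V_{B,n}}$ there is given a unitary $U_{n,x_{V_{B,n}}}$ on $|V_n|$ internal-variable qubits and $N_{\mathrm{ora},n}$ ancillas such that measuring the variable qubits of $U_{n,x_{V_{B,n}}}|0\rangle$ gives a maximizer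 of $g_{n,x_{V_{B,n}}}$ with probability at least $p_{\min,n}>0$ ($p_{\min,n}$ not depending on $x_{V_{B,n}}$). *Parameters.* $0<\delta<1$, $N_p\ge1$, and $$t(c,\delta)=\max\Bigl(0,\bigl\lceil-\tfrac12\log_2(\delta c)-\tfrac12\bigr\rceil\Bigr),\qquad p_{\min,c}=\frac{(1-\delta)^{2N_pN_G}}{|\mathcal X_{V_B}|},\qquad t_c=t(p_{\min,c},\delta),\quad t_n=t(p_{\min,n},\delta).$$ *Network and registers.* There are a coordinator and workers $1,\dots,N_G$; a processor acts on the qubits it holds, and qubits are teleported between processors. Initially the coordinator holds the boundary register ($|V_B|$ qubits), an estimation register ($t_c$), a result register ($N_p$), for each $n$ a register $\mathrm{Baux}_n$ for copies of boundary bits ($|V_{B,n}|$) and a register for copies of the estimation qubits ($t_c$), and three single ancillas (zero check, global zero check, and one ancilla for marking and error mitigation). Worker $n$ holds an estimation register ($t_n$), the internal variables ($|V_n|$), a local result register ($N_p$), the oracle ancillas ($N_{\mathrm{ora},n}$), and one zero-check qubit. All qubits start in $|0\rangle$. Teleporting a qubit consumes one EPR pair per link of a shortest path between the two processors. *The algorithm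 $A_{\mathrm{dist}}$.* - *Phase test* for a preparation $U$, an amplitude-amplification operator $Q$, a $t$-qubit estimation register and a target bit: apply $U$; apply quantum phase estimation of $Q$ (Hadamards, controlled $Q^{2^k}$ for $k=0,\dots,t-1$, inverse Fourier transform); flip the target bit if the estimation register is non-zero; apply the inverses of the phase estimation and of $U$; error mitigation: unless the workspace is zero, swap the target bit with an ancilla. - *Local maximization* at worker $n$: for $i=1,\dots,N_p$ run the phase test with $U$ the leaf oracle controlled by $\mathrm{Baux}_n$, $Q=U\,(2|0\rangle\langle0|-I)\,U^{\mathsf H}\,M$, target bit $i$ of the local result, where $M$ flips the phase if $g_{n,x_{V_{B,n}}}(x_{V_n})\ge 0.z_1\dots z_{i-1}1$ (binary), $z_1,\dots,z_{i-1}$ being the bits of the local result found so far. - *State preparation* $U_{\mathrm{ini}}$: the coordinator applies Hadamards to the boundary register, copies the bits in $V_{B,n}$ to $\mathrm{Baux}_n$ by CNOTs and teleports $\mathrm{Baux}_n$ to worker $n$; every worker runs its local maximization and teleports $\mathrm{Baux}_n$ and its local result to the coordinator, which uncomputes the copies. $U_{\mathrm{ini}}^{\mathsf H}$ performs all steps inverted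 and in reverse order. - *Zero check and reflection*: every processor flips its zero-check qubit if its data qubits are zero; the workers teleport their zero-check qubits to the coordinator, which flips the global one if all are $1$. The reflection $2|0\rangle\langle0|-I$ performs the zero check, a phase $-1$ if the global qubit is $0$, and the inverse of the zero check. - *Main loop*: for $i=1,\dots,N_p$ run the phase test with $U=U_{\mathrm{ini}}$, the coordinator's estimation register, target bit $i$ of its result register, and $Q=U_{\mathrm{ini}}(2|0\rangle\langle0|-I)U_{\mathrm{ini}}^{\mathsf H}M$, where $M$, executed at the coordinator, flips the phase if the sum of the local results is at least $0.z_1\dots z_{i-1}1$, $z_1,\dots,z_{i-1}$ being the bits of the coordinator's result found so far. Before each controlled $Q^{2^k}$ the coordinator copies the $k$-th estimation qubit for each worker and teleports the copies to the workers; afterwards they are returned and uncomputed; all gates of $Q$ at a processor are controlled by the qubit it thus holds. Error mitigation uses the distributed zero check and its inverse. In the inverse of the phase estimation every instruction, including every teleportation, is inverted, in reverse order. **Theorem (overall algorithm performance).** There is an absolute constant $C>0$ such that for every instance as above the following holds. 0. $A_{\mathrm{dist}}$ is executable using only gates and oracle queries on qubits that are at one processor at that time, and teleportations. 1. *Total qubit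 count.* The number of qubits in the network is $$|V_B|+(N_p+t_c)+\sum_{n}(N_p+t_n+|V_n|)+3+\sum_n\bigl(|V_{B,n}|+N_{\mathrm{ora},n}+t_c+1\bigr).$$ 2. *Qubits per processor.* The number of distinct qubits that the coordinator holds at some time of the execution is $$N_{\mathrm{qubits}}(\mathrm{QPU}_c)=|V_B|+t_c+N_p+N_G(N_p+1)+\sum_n|V_{B,n}|+N_Gt_c+3\;\le\; C\,N_G\Bigl(|V|+N_pN_G\bigl(1+\log\tfrac1\delta+\log\tfrac1{1-\delta}\bigr)\Bigr),$$ and for worker $n$ it is $$N_{\mathrm{qubits}}(\mathrm{QPU}_n)=|V_n|+|V_{B,n}|+N_p+t_n+N_{\mathrm{ora},n}+t_c+1.$$ 3. *Query complexity.* The total number of queries to the leaf oracles and their inverses is $$C_{\mathrm{distr}}=N_p^2\,(2^{t_c+2}-2)\sum_n(2^{t_n+2}-2)\;\le\;\frac C\delta\,N_p^2(1-\delta)^{-N_pN_G}\sum_n\sqrt{|\mathcal X_{V_B}|/p_{\min,n}}.$$ If moreover $p_{\min,n}\ge1/|\mathcal X_{V_n}|$ for all $n$ (as for oracles that prepare the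 uniform superposition), then $$C_{\mathrm{distr}}\le\frac C\delta\,N_p^2(1-\delta)^{-N_pN_G}\sum_n\sqrt{|\mathcal X_{V_B}|\,|\mathcal X_{V_n}|}.$$ 4. *Entanglement.* In every single-hop network (the coordinator is directly connected to all workers) the total number of EPR pairs consumed is $$N_{\mathrm{EPR}}=N_p(2^{t_c+2}-2)\sum_n(2|V_{B,n}|+N_p)+N_p(2^{t_c+2}-4)N_G+N_pt_c\cdot2N_G+\bigl(N_pt_c\cdot2N_G+N_p\cdot2N_G\bigr),$$ where the last bracket is due to the distribution of the control qubits in the inverse phase estimations and to the zero checks of the error mitigation, and $$N_{\mathrm{EPR}}\le\frac{C}{\sqrt\delta}\,(N_G+N_p)\;N_p(1-\delta)^{-N_pN_G}\,|V|\,\sqrt{|\mathcal X_{V_B}|}.$$ -/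

import Mathlib

noncomputable section

open scoped Classical

/-! ## Factor graphs with binary variables and their boundary-based split -/

/-- A factor graph with binary variables, nonnegative local functions, and a global function
with values in `[0, 1]`. `adj f v` says that the variable node `v` is adjacent to `f`. -/
structure FactorGraph (V : Type*) (F : Type*) [Fintype V] [Fintype F] where
  adj : F → V → Prop
  localFun : (f : F) → ({v : V // adj f v} → Bool) → ℝ
  localFun_nonneg : ∀ f x, 0 ≤ localFun f x
  global_le_one : ∀ x : V → Bool, ∑ f, localFun f (fun v => x v) ≤ 1

namespace FactorGraph

variable {V : Type*} {F : Type*} [Fintype V] [Fintype F] (G : FactorGraph V F) (B : Finset V)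

/-- The bipartite graph obtained by deleting the boundary variables and their edges. -/
def reduced : SimpleGraph (F ⊕ {v : V // v ∉ B}) :=
  SimpleGraph.fromRel fun a b => ∃ f v, a = Sum.inl f ∧ b = Sum.inr v ∧ G.adj f v

/-- The subgraphs of the split: the connected components of the reduced graph that contain at
least one variable node. -/
def Part : Type _ :=
  {c : (G.reduced B).ConnectedComponent //
    ∃ v, (G.reduced B).connectedComponentMk (Sum.inr v) = c}

instance : Finite (G.Part B) := by
  unfold Part
  have : Finite (G.reduced B).ConnectedComponent :=
    Quot.finite _
  infer_instance

instance : Fintype (G.Part B) := Fintype.ofFinite _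

/-- The number of subgraphs, which is the number of workers. -/
abbrev numParts : ℕ := Fintype.card (G.Part B)

/-- The number of configurations of the boundary variables. -/
abbrev numBdryConfigs (_ : FactorGraph V F) (B : Finset V) : ℕ := Nat.card ({v : V // v ∈ B} → Bool)

variable {B}

/-- The variable nodes of a subgraph. -/
abbrev IntVar (n : G.Part B) : Type _ :=
  {v : V // ∃ h : v ∉ B, (G.reduced B).connectedComponentMk (Sum.inr ⟨v, h⟩) = n.1}

/-- The function nodes of a subgraph. -/
abbrev Factor (n : G.Part B) : Type _ :=
  {f : F // (G.reduced B).connectedComponentMk (Sum.inl f) = n.1}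

/-- The boundary neighbourhood of a subgraph. -/
abbrev BdryVar (n : G.Part B) : Type _ :=
  {v : V // v ∈ B ∧ ∃ f : G.Factor n, G.adj f.1 v}

/-- The local conditioned objective of a subgraph. The variables of a factor of the subgraph are
internal variables or boundary neighbours of the subgraph, so the default value `false` is never
read. -/
def localObj (n : G.Part B) (xB : G.BdryVar n → Bool) (x : G.IntVar n → Bool) : ℝ :=
  ∑ f : G.Factor n, G.localFun f.1 fun v =>
    if h : v.1 ∈ B ∧ ∃ f : G.Factor n, G.adj f.1 v.1 then xB ⟨v.1, h⟩
    else if h : ∃ h : v.1 ∉ B, (G.reduced B).connectedComponentMk (Sum.inr ⟨v.1, h⟩) = n.1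
      then x ⟨v.1, h⟩ else false

/-- The maximizers of the local conditioned objective. -/
def localArgmax (n : G.Part B) (xB : G.BdryVar n → Bool) : Set (G.IntVar n → Bool) :=
  {x | ∀ y, G.localObj n xB y ≤ G.localObj n xB x}

variable (B)

/-- The local oracles: for each subgraph `n` and each configuration of its boundary neighbourhood,
a unitary on the internal-variable qubits and `numAnc n` ancilla qubits which maps the all-zero
state to a state whose weight on the maximizers is at least `pmin n > 0`. -/
structure LocalOracles where
  numAnc : G.Part B → ℕ
  U : (n : G.Part B) → (G.BdryVar n → Bool) →
    Matrix ((G.IntVar n → Bool) × (Fin (numAnc n) → Bool))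
      ((G.IntVar n → Bool) × (Fin (numAnc n) → Bool)) ℂ
  unitary : ∀ n xB, U n xB ∈ Matrix.unitaryGroup _ ℂ
  pmin : G.Part B → ℝ
  pmin_pos : ∀ n, 0 < pmin n
  overlap : ∀ n xB, pmin n ≤
    ∑ s, if s.1 ∈ G.localArgmax n xB
      then ‖U n xB s (fun _ => false, fun _ => false)‖ ^ 2 else 0

end FactorGraph

/-! ## Distributed quantum programs -/

namespace DistQ

/-- The processors of the network: a coordinator and the workers. -/
inductive Proc (W : Type*)
  | coord : Proc W
  | worker (n : W) : Proc W

/-- A gate on the qubits of `supp`, given by its matrix in the computational basis. -/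
structure Gate (Q : Type*) where
  supp : Finset Q
  mat : Matrix (supp → Bool) (supp → Bool) ℂ

namespace Gate

variable {Q : Type*}

/-- Extend an assignment on a set of qubits by zero. -/
def ext {S : Finset Q} (y : S → Bool) : Q → Bool :=
  fun q => if h : q ∈ S then y ⟨q, h⟩ else false

/-- The inverse gate. -/
def adjoint (g : Gate Q) : Gate Q := ⟨g.supp, g.mat.conjTranspose⟩

/-- The Hadamard gate. -/
def hadamard (q : Q) : Gate Q :=
  ⟨{q}, fun x y => (if ext x q && ext y q then -1 else 1) / (Real.sqrt 2 : ℂ)⟩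

/-- Flip `tgt` if the qubits of `S` satisfy `P` (`tgt ∉ S` in all uses). -/
def flipIf (S : Finset Q) (P : (Q → Bool) → Prop) (tgt : Q) : Gate Q :=
  ⟨insert tgt S, fun x y =>
    if ext x = Function.update (ext y) tgt (xor (ext y tgt) (decide (P (ext y)))) then 1 else 0⟩

/-- The controlled NOT gate. -/
def cnot (ctl tgt : Q) : Gate Q := flipIf {ctl} (fun y => y ctl = true) tgt

/-- Swap `a` and `b` if the qubits of `S` satisfy `P` (`a, b ∉ S` in all uses). -/
def swapIf (S : Finset Q) (P : (Q → Bool) → Prop) (a b : Q) : Gate Q :=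
  ⟨insert a (insert b S), fun x y =>
    if ext x = (if P (ext y) then ext y ∘ Equiv.swap a b else ext y) then 1 else 0⟩

/-- Apply the phase `-1` if the qubits of `S` satisfy `P`. -/
def phaseIf (S : Finset Q) (P : (Q → Bool) → Prop) : Gate Q :=
  ⟨S, Matrix.diagonal fun y => if P (ext y) then -1 else 1⟩

/-- The quantum Fourier transform on a register whose `k`-th qubit has weight `2 ^ k`. -/
def qft {t : ℕ} (r : Fin t → Q) : Gate Q :=
  ⟨Finset.univ.image r, fun x y =>
    Complex.exp (2 * Real.pi * Complex.I *
      (∑ k, if ext x (r k) then (2 : ℂ) ^ (k : ℕ) else 0) *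
      (∑ k, if ext y (r k) then (2 : ℂ) ^ (k : ℕ) else 0) / 2 ^ t) / (Real.sqrt (2 ^ t) : ℂ)⟩

/-- The action on state vectors of the gate, controlled by the qubits of `ctrls`. -/
def act (g : Gate Q) (ctrls : Finset Q) (ψ : (Q → Bool) → ℂ) : (Q → Bool) → ℂ := fun x =>
  if ∀ c ∈ ctrls, x c = true then
    ∑ y : g.supp → Bool, g.mat (fun q => x q) y *
      ψ (fun q => if h : q ∈ g.supp then y ⟨q, h⟩ else x q)
  else ψ x

end Gate

/-- Instructions of a distributed program with qubits `Q` and workers `W`: a local gate at a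
processor, a query to the oracle of a worker or to its inverse (`adj`), both controlled by the
qubits of `ctrls`, and the teleportation of a qubit between two processors. -/
inductive Instr (Q : Type*) (W : Type*)
  | gate (p : Proc W) (ctrls : Finset Q) (g : Gate Q)
  | query (n : W) (adj : Bool) (ctrls : Finset Q)
  | teleport (q : Q) (src dst : Proc W)

namespace Instr

variable {Q W : Type*}

def inverse : Instr Q W → Instr Q W
  | gate p ctrls g => gate p ctrls g.adjoint
  | query n adj ctrls => query n (!adj) ctrls
  | teleport q src dst => teleport q dst src

/-- Control by the qubit `κ p` every gate that processor `p` executes. -/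
def controlBy (κ : Proc W → Q) : Instr Q W → Instr Q W
  | gate p ctrls g => gate p (insert (κ p) ctrls) g
  | query n adj ctrls => query n adj (insert (κ (.worker n)) ctrls)
  | teleport q src dst => teleport q src dst

/-- Whether the instruction can be executed when the qubits are located according to `loc`, using
only operations on qubits at one processor and teleportations from the current location. The
oracle of worker `n` acts on the qubits of `orc n`. -/
def Executable (orc : W → Gate Q) (loc : Q → Proc W) : Instr Q W → Prop
  | gate p ctrls g => Disjoint ctrls g.supp ∧ ∀ q ∈ ctrls ∪ g.supp, loc q = p
  | query n _ ctrls =>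
      Disjoint ctrls (orc n).supp ∧ ∀ q ∈ ctrls ∪ (orc n).supp, loc q = .worker n
  | teleport q src _ => loc q = src

/-- The locations of the qubits after the instruction. -/
def move (loc : Q → Proc W) : Instr Q W → Q → Proc W
  | teleport q _ dst => Function.update loc q dst
  | _ => loc

/-- The action of the instruction on state vectors. -/
def act (orc : W → Gate Q) (ψ : (Q → Bool) → ℂ) : Instr Q W → (Q → Bool) → ℂ
  | gate _ ctrls g => g.act ctrls ψ
  | query n false ctrls => (orc n).act ctrls ψ
  | query n true ctrls => (orc n).adjoint.act ctrls ψ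
  | teleport _ _ _ => ψ

/-- The number of oracle queries. -/
def queries : Instr Q W → ℕ
  | query _ _ _ => 1
  | _ => 0

/-- The number of EPR pairs consumed: teleporting a qubit consumes one EPR pair for each link of a
shortest path between the two processors. -/
def eprPairs (N : SimpleGraph (Proc W)) : Instr Q W → ℕ
  | teleport _ src dst => N.dist src dst
  | _ => 0

end Instr

/-- A distributed program; the first instruction of the list is executed first. -/
abbrev Prog (Q : Type*) (W : Type*) := List (Instr Q W)

namespace Prog

variable {Q W : Type*}

def inverse (l : Prog Q W) : Prog Q W := (l.map Instr.inverse).reverse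

def controlBy (κ : Proc W → Q) (l : Prog Q W) : Prog Q W := l.map (Instr.controlBy κ)

def repeated (k : ℕ) (l : Prog Q W) : Prog Q W := (List.replicate k l).flatten

/-- The locations of the qubits after the program. -/
def move (loc : Q → Proc W) (l : Prog Q W) : Q → Proc W := l.foldl Instr.move loc

/-- Every instruction is executable at the time when it is executed. -/
def Executable (orc : W → Gate Q) : (Q → Proc W) → Prog Q W → Prop
  | _, [] => True
  | loc, i :: l => i.Executable orc loc ∧ Executable orc (i.move loc) l

/-- The action of the program on state vectors. -/
def act (orc : W → Gate Q) (ψ : (Q → Bool) → ℂ) (l : Prog Q W) : (Q → Bool) → ℂ :=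
  l.foldl (Instr.act orc) ψ

/-- The total number of oracle queries. -/
def queries (l : Prog Q W) : ℕ := (l.map Instr.queries).sum

/-- The total number of EPR pairs consumed in the network `N`. -/
def eprPairs (N : SimpleGraph (Proc W)) (l : Prog Q W) : ℕ := (l.map (Instr.eprPairs N)).sum

/-- The number of qubits that processor `p` holds at some time of the execution. -/
def qubitsAt (loc : Q → Proc W) (l : Prog Q W) (p : Proc W) : ℕ :=
  Set.ncard {q | ∃ l', l' <+: l ∧ move loc l' q = p}

end Prog

/-! ## The distributed optimization algorithm -/

/-- The size of the estimation register for overlap `c` and error `δ`. -/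
def estSize (c δ : ℝ) : ℕ := ⌈-(1 / 2) * Real.logb 2 (δ * c) - 1 / 2⌉₊

/-- The value of a binary fraction. -/
def zdec {N : ℕ} (z : Fin N → Bool) : ℝ := ∑ k, if z k then (1 / 2 : ℝ) ^ ((k : ℕ) + 1) else 0

/-- The string `(z 0, …, z (i - 1), 1, 0, …, 0)`. -/
def candidate {N : ℕ} (z : Fin N → Bool) (i : Fin N) : Fin N → Bool :=
  fun j => if j < i then z j else decide (j = i)

variable {V : Type*} {F : Type*} [Fintype V] [Fintype F] {G : FactorGraph V F} {B : Finset V}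
  (O : G.LocalOracles B) (δ : ℝ) (Np : ℕ)

/-- The lower bound on the overlap at the coordinator,
`(1 - δ) ^ (2 Np N_G) / |X_{V_B}|`. -/
def pminC (_ : G.LocalOracles B) (δ : ℝ) (Np : ℕ) : ℝ :=
  (1 - δ) ^ (2 * Np * G.numParts B) / G.numBdryConfigs B

/-- The number of qubits of the coordinator's estimation register. -/
def tC : ℕ := estSize (pminC O δ Np) δ

/-- The number of qubits of a worker's estimation register. -/
def tW (n : G.Part B) : ℕ := estSize (O.pmin n) δ

/-- The qubits of the network. -/
inductive Qubit : Type _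
  /-- boundary variables -/
  | bdry (v : {v : V // v ∈ B})
  /-- the coordinator's estimation register -/
  | est (k : Fin (tC O δ Np))
  /-- the coordinator's result register -/
  | res (i : Fin Np)
  /-- a worker's estimation register -/
  | lest (n : G.Part B) (k : Fin (tW O δ n))
  /-- a worker's internal variables -/
  | lvar (n : G.Part B) (v : G.IntVar n)
  /-- a worker's result register -/
  | lres (n : G.Part B) (i : Fin Np)
  /-- copies of boundary variables for a worker -/
  | baux (n : G.Part B) (v : G.BdryVar n)
  /-- copies of the coordinator's estimation register for a worker -/
  | ctl (n : G.Part B) (k : Fin (tC O δ Np))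
  /-- the ancillas of a worker's oracle -/
  | anc (n : G.Part B) (j : Fin (O.numAnc n))
  /-- a worker's zero-check qubit -/
  | lcz (n : G.Part B)
  /-- the coordinator's zero-check qubit -/
  | cz
  /-- the coordinator's global zero-check qubit -/
  | gz
  /-- the coordinator's ancilla qubit for marking and for error mitigation -/
  | canc

/-- The total number of qubits in the network. -/
def totalQubits : ℕ := Nat.card (Qubit O δ Np)

namespace Qubit

variable {O δ Np}

/-- The initial location of a qubit. -/
def home : Qubit O δ Np → Proc (G.Part B)
  | lest n _ | lvar n _ | lres n _ | anc n _ | lcz n => .worker n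
  | _ => .coord

end Qubit

open Qubit

/-- Programs on the qubits of the network. -/
abbrev NetProg := Prog (Qubit O δ Np) (G.Part B)

/-- An uncontrolled gate at processor `p`. -/
abbrev at' (p : Proc (G.Part B)) (g : Gate (Qubit O δ Np)) : Instr (Qubit O δ Np) (G.Part B) :=
  .gate p ∅ g

/-- The list of all elements of a finite type. -/
def all (α : Type*) [Finite α] : List α := (@Finset.univ α (Fintype.ofFinite α)).toList

/-- The register of all qubits of the form `r a`. -/
def reg {α : Type*} [Finite α] (r : α → Qubit O δ Np) : Finset (Qubit O δ Np) :=
  (Set.finite_range r).toFinset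

/-- Some qubit of the set is in state `1`. -/
def NonZero (S : Finset (Qubit O δ Np)) (y : Qubit O δ Np → Bool) : Prop := ∃ q ∈ S, y q = true

/-- The oracle of worker `n`, conditioned on the boundary copies at the worker:
`∑ₓ |x⟩⟨x| ⊗ U n x`. -/
def oracle (n : G.Part B) : Gate (Qubit O δ Np) :=
  ⟨reg O δ Np (baux n) ∪ reg O δ Np (lvar n) ∪ reg O δ Np (anc n), fun x y =>
    if (∀ v, Gate.ext x (baux n v) = Gate.ext y (baux n v)) then
      O.U n (fun v => Gate.ext x (baux n v))
        (fun v => Gate.ext x (lvar n v), fun j => Gate.ext x (anc n j))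
        (fun v => Gate.ext y (lvar n v), fun j => Gate.ext y (anc n j))
    else 0⟩

/-! ### Local maximization at a worker -/

/-- The target register of the local phase estimation. -/
def localTarget (n : G.Part B) : Finset (Qubit O δ Np) :=
  reg O δ Np (lvar n) ∪ reg O δ Np (anc n)

/-- Mark the internal configurations whose objective is at least the candidate threshold. -/
def localMark (n : G.Part B) (i : Fin Np) : Gate (Qubit O δ Np) :=
  .phaseIf (reg O δ Np (baux n) ∪ reg O δ Np (lvar n) ∪ reg O δ Np (lres n)) fun y =>
    zdec (candidate (fun j => y (lres n j)) i) ≤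
      G.localObj n (fun v => y (baux n v)) (fun v => y (lvar n v))

/-- The local amplitude amplification operator. -/
def localAA (n : G.Part B) (i : Fin Np) : NetProg O δ Np :=
  [at' O δ Np (.worker n) (localMark O δ Np n i),
   .query n true ∅,
   at' O δ Np (.worker n) (.phaseIf (localTarget O δ Np n) (NonZero O δ Np (localTarget O δ Np n))),
   .query n false ∅]

/-- Local phase estimation. -/
def localQPE (n : G.Part B) (i : Fin Np) : NetProg O δ Np :=
  (List.finRange (tW O δ n)).map (fun k : Fin (tW O δ n) => at' O δ Np (.worker n) (.hadamard (.lest n k))) ++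
  (List.finRange (tW O δ n)).flatMap (fun k : Fin (tW O δ n) =>
    Prog.repeated (2 ^ (k : ℕ)) (Prog.controlBy (fun _ => lest n k) (localAA O δ Np n i))) ++
  [at' O δ Np (.worker n) (Gate.qft (lest n)).adjoint]

/-- The local approximately reversible phase test, which writes bit `i` of the local result. -/
def localTest (n : G.Part B) (i : Fin Np) : NetProg O δ Np :=
  [.query n false ∅] ++ localQPE O δ Np n i ++
  [at' O δ Np (.worker n) (.flipIf (reg O δ Np (lest n))
    (NonZero O δ Np (reg O δ Np (lest n))) (lres n i))] ++
  Prog.inverse (localQPE O δ Np n i) ++ [.query n true ∅] ++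
  [at' O δ Np (.worker n) (.swapIf (reg O δ Np (lest n) ∪ localTarget O δ Np n)
    (NonZero O δ Np (reg O δ Np (lest n) ∪ localTarget O δ Np n)) (lres n i) (lcz n))]

/-- Local maximization. -/
def uMax (n : G.Part B) : NetProg O δ Np :=
  (List.finRange Np).flatMap (localTest O δ Np n)

/-! ### State preparation, amplitude amplification and phase test in the network -/

/-- The fan-out of the boundary register. -/
def fanOut (n : G.Part B) : NetProg O δ Np :=
  (all (G.BdryVar n)).map fun v => at' O δ Np .coord (.cnot (bdry ⟨v.1, v.2.1⟩) (baux n v))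

/-- The distributed state preparation. It leaves the local result registers at the coordinator,
where the marking operator needs them; its inverse starts by returning them to the workers. -/
def uIni : NetProg O δ Np :=
  (all {v : V // v ∈ B}).map (fun v => at' O δ Np .coord (.hadamard (bdry v))) ++
  (all (G.Part B)).flatMap (fun n => fanOut O δ Np n ++
    (all (G.BdryVar n)).map (fun v => .teleport (baux n v) .coord (.worker n))) ++
  (all (G.Part B)).flatMap (uMax O δ Np) ++
  (all (G.Part B)).flatMap (fun n =>
    (all (G.BdryVar n)).map (fun v => .teleport (baux n v) (.worker n) .coord) ++
    (List.finRange Np).map (fun i => .teleport (lres n i) (.worker n) .coord)) ++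
  (all (G.Part B)).flatMap (fun n => Prog.inverse (fanOut O δ Np n))

/-- The marking operator: phase `-1` if the sum of the local values is at least the candidate
threshold. The comparison is computed into `canc` and uncomputed. -/
def mark (i : Fin Np) : NetProg O δ Np :=
  let compare : Gate (Qubit O δ Np) := .flipIf
    (reg O δ Np res ∪ Finset.univ.biUnion fun n => reg O δ Np (lres n))
    (fun y => zdec (candidate (fun j => y (res j)) i) ≤
      ∑ n : G.Part B, zdec (fun j => y (lres n j))) canc
  [at' O δ Np .coord compare,
   at' O δ Np .coord (.phaseIf {canc} (fun y => y canc = true)),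
   at' O δ Np .coord compare.adjoint]

/-- The data qubits of a worker. -/
def workerData (n : G.Part B) : Finset (Qubit O δ Np) :=
  reg O δ Np (lest n) ∪ reg O δ Np (lvar n) ∪ reg O δ Np (lres n) ∪ reg O δ Np (anc n)

/-- The boundary register and its copies. -/
def coordData : Finset (Qubit O δ Np) :=
  reg O δ Np bdry ∪ Finset.univ.biUnion fun n => reg O δ Np (baux n)

/-- The distributed zero check: `gz` is flipped if the qubits of `S` at the coordinator and the
data qubits of all workers are zero. -/
def zeroCheck (S : Finset (Qubit O δ Np)) : NetProg O δ Np :=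
  [at' O δ Np .coord (.flipIf S (fun y => ¬ NonZero O δ Np S y) cz)] ++
  (all (G.Part B)).map (fun n => at' O δ Np (.worker n)
    (.flipIf (workerData O δ Np n) (fun y => ¬ NonZero O δ Np (workerData O δ Np n) y) (lcz n))) ++
  (all (G.Part B)).map (fun n => .teleport (lcz n) (.worker n) .coord) ++
  [at' O δ Np .coord (.flipIf (insert cz (reg O δ Np lcz))
    (fun y => y cz = true ∧ ∀ n, y (lcz n) = true) gz)]

/-- The reflection `2 |0⟩⟨0| - 1`. -/
def reflection : NetProg O δ Np :=
  zeroCheck O δ Np (coordData O δ Np) ++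
  [at' O δ Np .coord (.phaseIf {gz} (fun y => y gz = false))] ++
  Prog.inverse (zeroCheck O δ Np (coordData O δ Np))

/-- The amplitude amplification operator. -/
def uAA (i : Fin Np) : NetProg O δ Np :=
  mark O δ Np i ++ Prog.inverse (uIni O δ Np) ++ reflection O δ Np ++ uIni O δ Np

/-- Distribute copies of the `k`-th estimation qubit to all workers. -/
def distribute (k : Fin (tC O δ Np)) : NetProg O δ Np :=
  (all (G.Part B)).flatMap fun n =>
    [at' O δ Np .coord (.cnot (est k) (ctl n k)), .teleport (ctl n k) .coord (.worker n)]

/-- The local control qubits for the `k`-th estimation qubit. -/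
def control (k : Fin (tC O δ Np)) : Proc (G.Part B) → Qubit O δ Np
  | .coord => est k
  | .worker n => ctl n k

/-- The distributed application of the `2 ^ k`-th power of the amplitude amplification operator,
controlled by the `k`-th estimation qubit. -/
def controlledPower (i : Fin Np) (k : Fin (tC O δ Np)) : NetProg O δ Np :=
  distribute O δ Np k ++
  Prog.repeated (2 ^ (k : ℕ)) (Prog.controlBy (control O δ Np k) (uAA O δ Np i)) ++
  Prog.inverse (distribute O δ Np k)

/-- Distributed phase estimation. -/
def qpe (i : Fin Np) : NetProg O δ Np :=
  (List.finRange (tC O δ Np)).map (fun k => at' O δ Np .coord (.hadamard (est k))) ++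
  (List.finRange (tC O δ Np)).flatMap (controlledPower O δ Np i) ++
  [at' O δ Np .coord (Gate.qft est).adjoint]

/-- Error mitigation: unless the workspace is zero, swap the result bit with the ancilla. -/
def errorMitigation (i : Fin Np) : NetProg O δ Np :=
  let S := reg O δ Np est ∪ coordData O δ Np ∪ Finset.univ.biUnion fun n => reg O δ Np (ctl n)
  zeroCheck O δ Np S ++
  [at' O δ Np .coord (.swapIf {gz} (fun y => y gz = false) (res i) canc)] ++
  Prog.inverse (zeroCheck O δ Np S)

/-- The distributed, approximately reversible phase test, which writes bit `i` of the result. -/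
def phaseTest (i : Fin Np) : NetProg O δ Np :=
  uIni O δ Np ++ qpe O δ Np i ++
  [at' O δ Np .coord (.flipIf (reg O δ Np est) (NonZero O δ Np (reg O δ Np est)) (res i))] ++
  Prog.inverse (qpe O δ Np i) ++ Prog.inverse (uIni O δ Np) ++ errorMitigation O δ Np i

/-- The distributed algorithm; it is run on the all-zero state, and `res` is measured at its end. -/
def aDist : NetProg O δ Np := (List.finRange Np).flatMap (phaseTest O δ Np)

/-- The probability that the algorithm outputs `z`. -/
def outputProb (z : Fin Np → Bool) : ℝ :=
  ∑ᶠ x : Qubit O δ Np → Bool, if ∀ i, x (res i) = z i then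
    ‖Prog.act (oracle O δ Np) (fun y => if y = fun _ => false then 1 else 0) (aDist O δ Np) x‖ ^ 2
  else 0

end DistQ

end

/-! Every claim concerns the syntax of the program: where the qubits are, which teleportations
occur, how many queries are made. State vectors play no role. The single fact taken from the oracles
beyond positivity of `pmin` is `pmin_le_one`, which controls the register sizes.

Executability is proved in Hoare style. `Runs` composes under concatenation, loops, inversion and
control, and the family `placed` describes every location that occurs between blocks. State
preparation is not location-preserving: it leaves the local results at the coordinator.
Amplification is nevertheless a closed loop from that state, because it undoes the preparation,
reflects at the home locations, and prepares again. Adding controls is harmless because each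
processor holds its own control qubit and amplification never touches those qubits
(`notControl_uAA`).

A processor holds a qubit at some time iff the qubit starts there or some instruction teleports it
there (`exists_prefix_move_iff`). The qubit counts thus reduce to `teleport_mem_phaseTest` and a sum
over the kinds of qubits.

Queries and EPR pairs are additive weights that vanish on gates and ignore inversion and control, so
`cost_aDist` treats both. If preparation costs `u`, a zero check `z`, a distribution `e`, and `t` is
the register size, then one amplification costs `2u + 2z`. Phase estimation applies it `2 ^ t - 1`
times, and a phase test runs the estimation and its inverse. This gives the factor `2 + 4 * (2 ^ t -
1) = 2 ^ (t + 2) - 2` for `u`.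

The estimates follow from `2 ^ t ≤ 2 / √(δ c)` for overlap `c` (`two_pow_estSize_le`). At the
coordinator, the square root halves the exponent `2 * Np * N_G` in `pminC`. -/

noncomputable section

open scoped Classical

namespace DistQ

/-! ## Executability, resources and locations of composed programs -/

section Programs

variable {Q W : Type*}

/-! ### Supports of the elementary gates. -/

namespace Gate

@[simp] lemma supp_adjoint (g : Gate Q) : g.adjoint.supp = g.supp := rfl

@[simp] lemma supp_hadamard (q : Q) : (hadamard q).supp = {q} := rfl

@[simp] lemma supp_flipIf (S : Finset Q) (P : (Q → Bool) → Prop) (t : Q) :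
    (flipIf S P t).supp = insert t S := rfl

@[simp] lemma supp_cnot (c t : Q) : (cnot c t).supp = insert t {c} := rfl

@[simp] lemma supp_swapIf (S : Finset Q) (P : (Q → Bool) → Prop) (a b : Q) :
    (swapIf S P a b).supp = insert a (insert b S) := rfl

@[simp] lemma supp_phaseIf (S : Finset Q) (P : (Q → Bool) → Prop) :
    (phaseIf S P).supp = S := rfl

@[simp] lemma supp_qft {t : ℕ} (r : Fin t → Q) : (qft r).supp = Finset.univ.image r := rfl

end Gate

/-! ### Single instructions under inversion and control. -/

namespace Instr

/-- The qubits that an instruction acts on or moves. -/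
def touched (orc : W → Gate Q) : Instr Q W → Finset Q
  | gate _ ctrls g => ctrls ∪ g.supp
  | query n _ ctrls => ctrls ∪ (orc n).supp
  | teleport q _ _ => {q}

@[simp] lemma touched_inverse (orc : W → Gate Q) (i : Instr Q W) :
    i.inverse.touched orc = i.touched orc := by
  cases i <;> rfl

@[simp] lemma queries_inverse (i : Instr Q W) : i.inverse.queries = i.queries := by
  cases i <;> rfl

@[simp] lemma queries_controlBy (κ : Proc W → Q) (i : Instr Q W) :
    (i.controlBy κ).queries = i.queries := by
  cases i <;> rfl

@[simp] lemma eprPairs_inverse (N : SimpleGraph (Proc W)) (i : Instr Q W) :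
    i.inverse.eprPairs N = i.eprPairs N := by
  cases i <;> simp [inverse, eprPairs, SimpleGraph.dist_comm]

@[simp] lemma eprPairs_controlBy (N : SimpleGraph (Proc W)) (κ : Proc W → Q) (i : Instr Q W) :
    (i.controlBy κ).eprPairs N = i.eprPairs N := by
  cases i <;> rfl

lemma inverse_eq_teleport {i : Instr Q W} {q : Q} {s d : Proc W} :
    i.inverse = .teleport q s d ↔ i = .teleport q d s := by
  cases i <;> simp [inverse]; tauto

lemma controlBy_eq_teleport {κ : Proc W → Q} {i : Instr Q W} {q : Q} {s d : Proc W} :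
    i.controlBy κ = .teleport q s d ↔ i = .teleport q s d := by
  cases i <;> simp [controlBy]

lemma Executable.inverse {orc : W → Gate Q} {loc : Q → Proc W} {i : Instr Q W}
    (h : i.Executable orc loc) : i.inverse.Executable orc (i.move loc) := by
  cases i <;> simp_all [Instr.inverse, Executable, move]

/-- Executability of a teleportation says that the qubit really is at the source; otherwise sending
it back there would not restore the locations. -/
lemma Executable.move_inverse {orc : W → Gate Q} {loc : Q → Proc W} {i : Instr Q W}
    (h : i.Executable orc loc) : i.inverse.move (i.move loc) = loc := by
  cases i <;> simp_all [Instr.inverse, Executable, move]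

lemma Executable.controlBy {orc : W → Gate Q} {loc : Q → Proc W} {κ : Proc W → Q}
    {i : Instr Q W} (h : i.Executable orc loc) (hκ : ∀ p, loc (κ p) = p)
    (hi : ∀ p, κ p ∉ i.touched orc) : (i.controlBy κ).Executable orc loc := by
  cases i with
  | gate p c g =>
    simp only [touched, Finset.mem_union, not_or] at hi
    refine ⟨Finset.disjoint_insert_left.2 ⟨(hi p).2, h.1⟩, fun q hq => ?_⟩
    rw [Finset.insert_union, Finset.mem_insert] at hq
    rcases hq with rfl | hq
    exacts [hκ p, h.2 q hq]
  | query n b c =>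
    simp only [touched, Finset.mem_union, not_or] at hi
    refine ⟨Finset.disjoint_insert_left.2 ⟨(hi _).2, h.1⟩, fun q hq => ?_⟩
    rw [Finset.insert_union, Finset.mem_insert] at hq
    rcases hq with rfl | hq
    exacts [hκ _, h.2 q hq]
  | teleport q s d => exact h

@[simp] lemma move_controlBy (κ : Proc W → Q) (loc : Q → Proc W) (i : Instr Q W) :
    (i.controlBy κ).move loc = i.move loc := by
  cases i <;> rfl

lemma move_apply_of_not_touched {orc : W → Gate Q} {loc : Q → Proc W} {i : Instr Q W} {q : Q}
    (h : q ∉ i.touched orc) : i.move loc q = loc q := by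
  cases i <;> simp_all [move, touched]

end Instr

namespace Prog

/-! ### Total cost -/

/-- The sum of the weights of the instructions of a program. -/
def cost (w : Instr Q W → ℕ) (l : Prog Q W) : ℕ := (l.map w).sum

variable (w : Instr Q W → ℕ)

@[simp] lemma cost_nil : cost w [] = 0 := rfl

@[simp] lemma cost_cons (i : Instr Q W) (l : Prog Q W) : cost w (i :: l) = w i + cost w l := by
  simp [cost]

@[simp] lemma cost_append (l l' : Prog Q W) : cost w (l ++ l') = cost w l + cost w l' := by
  simp [cost]

lemma cost_map {α : Type*} (f : α → Instr Q W) (as : List α) :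
    cost w (as.map f) = (as.map fun a => w (f a)).sum := by
  simp [cost, Function.comp_def]

lemma cost_flatMap {α : Type*} (f : α → Prog Q W) (as : List α) :
    cost w (as.flatMap f) = (as.map fun a => cost w (f a)).sum := by
  induction as <;> simp_all

lemma cost_repeated (k : ℕ) (l : Prog Q W) : cost w (repeated k l) = k * cost w l := by
  induction k with
  | zero => simp [repeated]
  | succ k ih =>
    simp only [repeated, List.replicate_succ, List.flatten_cons, cost_append] at ih ⊢
    rw [ih]; ring

variable {w}

lemma cost_inverse (hw : ∀ i, w i.inverse = w i) (l : Prog Q W) :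
    cost w (inverse l) = cost w l := by
  simp [cost, inverse, Function.comp_def, hw, List.sum_reverse]

lemma cost_controlBy {κ : Proc W → Q} (hw : ∀ i, w (i.controlBy κ) = w i) (l : Prog Q W) :
    cost w (controlBy κ l) = cost w l := by
  simp [cost, controlBy, Function.comp_def, hw]

/-! ### Locations and executability -/

/-- Started with the qubits at the locations `a`, the program is executable and leaves the qubits
at the locations `b`. -/
def Runs (orc : W → Gate Q) (a : Q → Proc W) (l : Prog Q W) (b : Q → Proc W) : Prop :=
  Executable orc a l ∧ move a l = b

variable {orc : W → Gate Q} {a b c : Q → Proc W} {l l' : Prog Q W}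

lemma Runs.nil : Runs orc a [] a := ⟨trivial, rfl⟩

lemma Runs.cons {i : Instr Q W} (hi : i.Executable orc a) (h : Runs orc (i.move a) l b) :
    Runs orc a (i :: l) b :=
  ⟨⟨hi, h.1⟩, h.2⟩

lemma Runs.append (h : Runs orc a l b) (h' : Runs orc b l' c) : Runs orc a (l ++ l') c := by
  induction l generalizing a with
  | nil => obtain ⟨-, rfl⟩ := h; exact h'
  | cons i l ih => exact Runs.cons h.1.1 (ih ⟨h.1.2, h.2⟩)

lemma Runs.single {i : Instr Q W} (hi : i.Executable orc a) (h : i.move a = b) :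
    Runs orc a [i] b := ⟨⟨hi, trivial⟩, h⟩

lemma Runs.gate {p : Proc W} {g : Gate Q} (h : ∀ q ∈ g.supp, a q = p) :
    Runs orc a [.gate p ∅ g] a :=
  Runs.single (by simpa [Instr.Executable] using h) rfl

lemma Runs.query {n : W} {adj : Bool} (h : ∀ q ∈ (orc n).supp, a q = .worker n) :
    Runs orc a [.query n adj ∅] a :=
  Runs.single (by simpa [Instr.Executable] using h) rfl

lemma Runs.gate_controlBy {κ : Proc W → Q} {p : Proc W} {g : Gate Q} (hκ : a (κ p) = p)
    (h : ∀ q ∈ g.supp, a q = p ∧ q ≠ κ p) : Runs orc a [(Instr.gate p ∅ g).controlBy κ] a :=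
  Runs.single (by
    simp only [Instr.controlBy, Instr.Executable, LawfulSingleton.insert_empty_eq,
      Finset.disjoint_singleton_left, Finset.forall_mem_union, Finset.mem_singleton, forall_eq]
    exact ⟨fun hp => (h _ hp).2 rfl, hκ, fun q hq => (h q hq).1⟩) rfl

lemma Runs.query_controlBy {κ : Proc W → Q} {n : W} {adj : Bool}
    (hκ : a (κ (.worker n)) = .worker n)
    (h : ∀ q ∈ (orc n).supp, a q = .worker n ∧ q ≠ κ (.worker n)) :
    Runs orc a [(Instr.query n adj ∅).controlBy κ] a :=
  Runs.single (by
    simp only [Instr.controlBy, Instr.Executable, LawfulSingleton.insert_empty_eq,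
      Finset.disjoint_singleton_left, Finset.forall_mem_union, Finset.mem_singleton, forall_eq]
    exact ⟨fun hp => (h _ hp).2 rfl, hκ, fun q hq => (h q hq).1⟩) rfl

lemma Runs.map_gate {α : Type*} {p : α → Proc W} {g : α → Gate Q} {as : List α}
    (h : ∀ x, ∀ q ∈ (g x).supp, a q = p x) :
    Runs orc a (as.map fun x => .gate (p x) ∅ (g x)) a := by
  induction as with
  | nil => exact Runs.nil
  | cons x as ih => exact (Runs.gate (h x)).append ih

/-- Every instruction can be undone from the locations it produces, so the reversed list retraces
the path. Inverse blocks therefore need no location analysis of their own. -/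
lemma Runs.inverse (h : Runs orc a l b) : Runs orc b (Prog.inverse l) a := by
  induction l generalizing a with
  | nil => obtain ⟨-, rfl⟩ := h; exact Runs.nil
  | cons i l ih =>
    rw [Prog.inverse, List.map_cons, List.reverse_cons]
    exact (ih ⟨h.1.2, h.2⟩).append (Runs.single h.1.1.inverse h.1.1.move_inverse)

lemma Runs.flatMap {α : Type*} {f : α → Prog Q W} {as : List α}
    (h : ∀ x ∈ as, Runs orc a (f x) a) : Runs orc a (as.flatMap f) a := by
  induction as with
  | nil => exact Runs.nil
  | cons x as ih =>
    rw [List.flatMap_cons]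
    exact (h x (by simp)).append (ih fun y hy => h y (by simp [hy]))

lemma Runs.repeated (h : Runs orc a l a) (k : ℕ) : Runs orc a (Prog.repeated k l) a := by
  induction k with
  | zero => exact Runs.nil
  | succ k ih =>
    rw [Prog.repeated, List.replicate_succ, List.flatten_cons]
    exact h.append ih

/-- A loop without repetitions whose step for `x` changes the locations from those of the state
in which exactly the elements of `D` have been treated to those for `insert x D`. -/
lemma Runs.flatMap_of_nodup {α : Type*} {f : α → Prog Q W} {as : List α} (hn : as.Nodup)
    (s : (α → Prop) → Q → Proc W)
    (h : ∀ (D : α → Prop) (x : α), ¬ D x → Runs orc (s D) (f x) (s fun y => D y ∨ y = x)) :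
    Runs orc (s fun _ => False) (as.flatMap f) (s fun y => y ∈ as) := by
  -- Generalizing over the set already treated lets the induction continue from the middle of the
  -- loop.
  suffices H : ∀ D : α → Prop, (∀ x ∈ as, ¬ D x) →
      Runs orc (s D) (as.flatMap f) (s fun y => D y ∨ y ∈ as) by
    simpa using H (fun _ => False) (by simp)
  induction as with
  | nil => intro D _; simpa using Runs.nil
  | cons x as ih =>
    intro D hD
    rw [List.nodup_cons] at hn
    rw [List.flatMap_cons]
    refine (h D x (hD x (by simp))).append ?_
    have := ih hn.2 (fun y => D y ∨ y = x) fun y hy => by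
      rintro (h' | rfl)
      exacts [hD y (by simp [hy]) h', hn.1 hy]
    simpa only [List.mem_cons, or_assoc] using this

lemma Runs.map_of_nodup {α : Type*} {f : α → Instr Q W} {as : List α} (hn : as.Nodup)
    (s : (α → Prop) → Q → Proc W)
    (h : ∀ (D : α → Prop) (x : α), ¬ D x → Runs orc (s D) [f x] (s fun y => D y ∨ y = x)) :
    Runs orc (s fun _ => False) (as.map f) (s fun y => y ∈ as) := by
  have := Runs.flatMap_of_nodup (f := fun x => [f x]) hn s h
  rwa [← List.map_eq_flatMap] at this

/-- Teleporting the qubits of an injective register. -/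
lemma Runs.map_teleport {α : Type*} {r : α → Q} (hr : Function.Injective r) {as : List α}
    (hn : as.Nodup) {s d : Proc W} (ha : ∀ x, a (r x) = s) :
    Runs orc a (as.map fun x => .teleport (r x) s d)
      (fun q => if ∃ x ∈ as, r x = q then d else a q) := by
  have := Runs.map_of_nodup (orc := orc) (f := fun x => Instr.teleport (r x) s d) hn
    (fun D q => if ∃ x, D x ∧ r x = q then d else a q) ?_
  · simp only [false_and, exists_false, if_false] at this
    convert this
  · intro D x hx
    refine Runs.single ?_ ?_
    -- By injectivity of `r`, no earlier step of the loop has moved this qubit.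
    · have : ¬ ∃ y, D y ∧ r y = r x := by
        rintro ⟨y, hy, h⟩
        exact hx (hr h ▸ hy)
      simp only [Instr.Executable, this, if_false, ha]
    · funext q
      by_cases hq : q = r x
      · subst hq
        simp only [Instr.move, Function.update_self]
        rw [if_pos ⟨x, Or.inr rfl, rfl⟩]
      · simp only [Instr.move, Function.update_of_ne hq]
        congr 1
        simp only [or_and_right, exists_or, exists_eq_left, eq_iff_iff, iff_self_or]
        exact fun h => absurd h.symm hq

/-- Controls do not alter movement, and untouched control qubits never move, so they stay at their
processors throughout the run. -/
lemma Runs.controlBy {κ : Proc W → Q} (h : Runs orc a l b) (hκ : ∀ p, a (κ p) = p)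
    (hl : ∀ i ∈ l, ∀ p, κ p ∉ i.touched orc) : Runs orc a (Prog.controlBy κ l) b := by
  induction l generalizing a with
  | nil => exact h
  | cons i l ih =>
    refine Runs.cons (h.1.1.controlBy hκ (hl i (by simp))) ?_
    rw [Instr.move_controlBy]
    refine ih ⟨h.1.2, h.2⟩ (fun p => ?_) fun j hj => hl j (by simp [hj])
    rw [Instr.move_apply_of_not_touched (hl i (by simp) p), hκ]

/-! ### Qubits held by a processor -/

lemma mem_inverse {i : Instr Q W} : i ∈ inverse l ↔ ∃ j ∈ l, j.inverse = i := by
  simp [inverse]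

lemma mem_repeated {i : Instr Q W} {k : ℕ} : i ∈ repeated k l ↔ k ≠ 0 ∧ i ∈ l := by
  simp [repeated, List.mem_flatten, List.mem_replicate]

lemma teleport_mem_inverse {q : Q} {s d : Proc W} :
    .teleport q s d ∈ inverse l ↔ .teleport q d s ∈ l := by
  simp [mem_inverse, Instr.inverse_eq_teleport]

lemma teleport_mem_controlBy {κ : Proc W → Q} {q : Q} {s d : Proc W} :
    .teleport q s d ∈ controlBy κ l ↔ .teleport q s d ∈ l := by
  simp [controlBy, Instr.controlBy_eq_teleport]

/-- Only a teleportation with destination `p` can bring a qubit to `p`. This turns a statement about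
the whole execution into membership of an instruction in the list. -/
lemma exists_prefix_move_iff {q : Q} {p : Proc W} :
    (∃ l', l' <+: l ∧ move a l' q = p) ↔ a q = p ∨ ∃ s, .teleport q s p ∈ l := by
  constructor
  · rintro ⟨l', hl', h⟩
    suffices H : a q = p ∨ ∃ s, .teleport q s p ∈ l' from
      H.imp_right fun ⟨s, hs⟩ => ⟨s, hl'.subset hs⟩
    clear hl'
    induction l' generalizing a with
    | nil => exact Or.inl h
    | cons i l' ih =>
      rcases ih h with h | ⟨s, hs⟩
      · cases i with
        | gate _ _ _ => exact Or.inl h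
        | query _ _ _ => exact Or.inl h
        | teleport q' s d =>
          by_cases hq : q = q'
          · subst hq
            simp only [Instr.move, Function.update_self] at h
            exact Or.inr ⟨s, by simp [h]⟩
          · exact Or.inl (by simpa [Instr.move, hq] using h)
      · exact Or.inr ⟨s, by simp [hs]⟩
  · rintro (h | ⟨s, hs⟩)
    · exact ⟨[], List.nil_prefix, h⟩
    -- Stopping immediately after the teleportation gives the required prefix.
    · obtain ⟨l₁, l₂, rfl⟩ := List.append_of_mem hs
      refine ⟨l₁ ++ [.teleport q s p], ⟨l₂, by simp⟩, ?_⟩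
      simp [move, Instr.move]

lemma qubitsAt_eq (loc : Q → Proc W) (l : Prog Q W) (p : Proc W) :
    qubitsAt loc l p = Set.ncard {q | loc q = p ∨ ∃ s, .teleport q s p ∈ l} := by
  simp only [qubitsAt, exists_prefix_move_iff]

end Prog

end Programs

/-! ## Execution of the distributed optimization algorithm -/

section Algorithm

variable {V : Type*} {F : Type*} [Fintype V] [Fintype F] {G : FactorGraph V F} {B : Finset V}
  {O : G.LocalOracles B} {δ : ℝ} {Np : ℕ}

open Qubit

/-! ### Enumerations and qubit registers. -/

@[simp] lemma mem_all {α : Type*} [Finite α] (x : α) : x ∈ all α := by simp [all]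

lemma nodup_all (α : Type*) [Finite α] : (all α).Nodup := Finset.nodup_toList _

lemma sum_map_all {α : Type*} [Fintype α] (f : α → ℕ) : ((all α).map f).sum = ∑ x, f x := by
  rw [all, Finset.sum_map_toList, Subsingleton.elim (Fintype.ofFinite α) ‹Fintype α›]

lemma length_all (α : Type*) [Finite α] : (all α).length = Nat.card α := by
  let := Fintype.ofFinite α
  rw [all, Finset.length_toList, Finset.card_univ, Nat.card_eq_fintype_card]

lemma mem_reg {α : Type*} [Finite α] {r : α → Qubit O δ Np} {q : Qubit O δ Np} :
    q ∈ reg O δ Np r ↔ ∃ x, r x = q := by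
  simp only [reg, Set.Finite.mem_toFinset, Set.mem_range]

@[simp] lemma supp_oracle (n : G.Part B) : (oracle O δ Np n).supp =
    reg O δ Np (baux n) ∪ reg O δ Np (lvar n) ∪ reg O δ Np (anc n) := rfl

lemma forall_mem_reg {α : Type*} [Finite α] {r : α → Qubit O δ Np} {P : Qubit O δ Np → Prop} :
    (∀ q ∈ reg O δ Np r, P q) ↔ ∀ x, P (r x) := by
  simp only [mem_reg, forall_exists_index, forall_apply_eq_imp_iff]

lemma forall_mem_biUnion {S : G.Part B → Finset (Qubit O δ Np)} {P : Qubit O δ Np → Prop} :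
    (∀ q ∈ Finset.univ.biUnion S, P q) ↔ ∀ n, ∀ q ∈ S n, P q := by
  simp only [Finset.mem_biUnion, Finset.mem_univ, true_and, forall_exists_index]
  exact forall_comm

/-- The locations of the qubits when the copies of boundary variables are at the workers in `D`,
the local results of the workers in `L` and the zero-check qubits of the workers in `Z` are at the
coordinator, and the copies of estimation qubits in `c` are at the workers. -/
def placed (D L Z : G.Part B → Prop) (c : G.Part B → Fin (tC O δ Np) → Prop) :
    Qubit O δ Np → Proc (G.Part B)
  | baux n _ => if D n then .worker n else .coord
  | lres n _ => if L n then .coord else .worker n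
  | lcz n => if Z n then .coord else .worker n
  | ctl n k => if c n k then .worker n else .coord
  | lest n _ | lvar n _ | anc n _ => .worker n
  | _ => .coord

lemma home_eq_placed : (home : Qubit O δ Np → _) =
    placed (fun _ => False) (fun _ => False) (fun _ => False) (fun _ _ => False) := by
  funext q
  cases q <;> simp [home, placed]

variable {D L Z : G.Part B → Prop} {c : G.Part B → Fin (tC O δ Np) → Prop}

/-! ### Local maximization -/

/-- The oracle reads the boundary copies and the marking reads the local result, so the former must
be at the worker and the latter must not have left it. -/
lemma runs_localQPE {n : G.Part B} (hD : D n) (hL : ¬ L n) (i : Fin Np) :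
    Prog.Runs (oracle O δ Np) (placed D L Z c) (localQPE O δ Np n i) (placed D L Z c) := by
  refine Prog.Runs.append (b := placed D L Z c) (Prog.Runs.append (b := placed D L Z c)
    (Prog.Runs.map_gate fun k => ?_) (Prog.Runs.flatMap fun k _ => Prog.Runs.repeated ?_ _))
    (Prog.Runs.gate ?_)
  · simp [placed]
  -- The control `lest n k` is the same for all processors and lives only at worker `n`. The general
  -- `Prog.Runs.controlBy`, which wants a control at every processor, does not apply, so the four
  -- instructions are treated singly.
  · refine (Prog.Runs.gate_controlBy rfl ?_).append ((Prog.Runs.query_controlBy rfl ?_).append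
      ((Prog.Runs.gate_controlBy rfl ?_).append (Prog.Runs.query_controlBy rfl ?_))) <;>
      simp only [Finset.forall_mem_union, Gate.supp_phaseIf, localMark, localTarget,
        forall_mem_reg, placed, supp_oracle, hD, hL, if_true, if_false] <;> simp
  · simp [placed]

/-- The zero-check qubit doubles as the ancilla of the local error mitigation, hence the condition
on `Z`. -/
lemma runs_localTest {n : G.Part B} (hD : D n) (hL : ¬ L n) (hZ : ¬ Z n) (i : Fin Np) :
    Prog.Runs (oracle O δ Np) (placed D L Z c) (localTest O δ Np n i) (placed D L Z c) := by
  refine (((((Prog.Runs.query ?_).append (runs_localQPE hD hL i)).append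
    (Prog.Runs.gate ?_)).append (runs_localQPE hD hL i).inverse).append
    (Prog.Runs.query ?_)).append (Prog.Runs.gate ?_) <;>
    simp only [Finset.forall_mem_insert, Finset.forall_mem_union, Gate.supp_flipIf,
      Gate.supp_swapIf, localTarget, forall_mem_reg, supp_oracle, placed, hD, hL, hZ, if_true,
      if_false] <;> simp

lemma runs_uMax {n : G.Part B} (hD : D n) (hL : ¬ L n) (hZ : ¬ Z n) :
    Prog.Runs (oracle O δ Np) (placed D L Z c) (uMax O δ Np n) (placed D L Z c) :=
  Prog.Runs.flatMap fun i _ => runs_localTest hD hL hZ i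

/-! ### State preparation -/

lemma runs_fanOut {n : G.Part B} (hD : ¬ D n) :
    Prog.Runs (oracle O δ Np) (placed D L Z c) (fanOut O δ Np n) (placed D L Z c) :=
  Prog.Runs.map_gate fun v => by simp [placed, hD]

lemma runs_teleport_baux {n : G.Part B} (hD : ¬ D n) :
    Prog.Runs (oracle O δ Np) (placed D L Z c)
      ((all (G.BdryVar n)).map fun v => .teleport (baux n v) .coord (.worker n))
      (placed (fun m => D m ∨ m = n) L Z c) := by
  have := Prog.Runs.map_teleport (orc := oracle O δ Np) (a := placed D L Z c) (r := baux n)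
    (fun _ _ h => by simpa using h) (nodup_all _) (s := .coord) (d := .worker n)
    (by simp [placed, hD])
  convert this using 1
  funext q
  cases q with
  | baux m v =>
    by_cases h : m = n
    · subst h; simp [placed, -Subtype.exists]
    · simp [placed, h, Ne.symm h]
  | _ => simp [placed]

lemma runs_teleport_lres {n : G.Part B} (hL : ¬ L n) :
    Prog.Runs (oracle O δ Np) (placed D L Z c)
      ((List.finRange Np).map fun i => .teleport (lres n i) (.worker n) .coord)
      (placed D (fun m => L m ∨ m = n) Z c) := by
  have := Prog.Runs.map_teleport (orc := oracle O δ Np) (a := placed D L Z c) (r := lres n)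
    (fun _ _ h => by simpa using h) (List.nodup_finRange _) (s := .worker n) (d := .coord)
    (by simp [placed, hL])
  convert this using 1
  funext q
  cases q with
  | lres m v =>
    by_cases h : m = n
    · subst h; simp [placed]
    · simp [placed, h, Ne.symm h]
  | _ => simp [placed]

lemma runs_return_baux {n : G.Part B} (hD : D n) :
    Prog.Runs (oracle O δ Np) (placed D L Z c)
      ((all (G.BdryVar n)).map fun v => .teleport (baux n v) (.worker n) .coord)
      (placed (fun m => D m ∧ m ≠ n) L Z c) := by
  have := Prog.Runs.map_teleport (orc := oracle O δ Np) (a := placed D L Z c) (r := baux n)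
    (fun _ _ h => by simpa using h) (nodup_all _) (s := .worker n) (d := .coord)
    (by simp [placed, hD])
  convert this using 1
  funext q
  cases q with
  | baux m v =>
    by_cases h : m = n
    · subst h; simp [placed, -Subtype.exists]
    · simp [placed, h, Ne.symm h]
  | _ => simp [placed]

/-- The path is asymmetric: the boundary copies make a round trip, while the local results end at
the coordinator, where the marking needs them. -/
lemma runs_uIni : Prog.Runs (oracle O δ Np)
    (placed (fun _ => False) (fun _ => False) (fun _ => False) c) (uIni O δ Np)
    (placed (fun _ => False) (fun _ => True) (fun _ => False) c) := by
  have h₁ := Prog.Runs.flatMap_of_nodup (nodup_all (G.Part B))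
    (fun D => placed (O := O) (δ := δ) (Np := Np) D (fun _ => False) (fun _ => False) c)
    (fun D n hn => (runs_fanOut hn).append (runs_teleport_baux hn))
  -- In the returning loop a worker gives back its copies and its results together, so the copies
  -- are at exactly the workers outside `L`.
  have h₂ := Prog.Runs.flatMap_of_nodup (nodup_all (G.Part B))
    (fun L => placed (O := O) (δ := δ) (Np := Np) (fun n => ¬ L n) L (fun _ => False) c)
    (fun L n hn => (runs_return_baux hn).append <| by
      simpa only [not_or, ne_eq] using runs_teleport_lres hn)
  simp only [mem_all, not_true_eq_false, not_false_eq_true] at h₁ h₂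
  refine ((((Prog.Runs.map_gate fun v => ?_).append h₁).append
    (Prog.Runs.flatMap fun n _ => runs_uMax trivial id id)).append h₂).append
    (Prog.Runs.flatMap fun n _ => (runs_fanOut id).inverse)
  simp [placed]

/-! ### Amplitude amplification -/

lemma runs_mark (i : Fin Np) : Prog.Runs (oracle O δ Np)
    (placed D (fun _ => True) Z c) (mark O δ Np i) (placed D (fun _ => True) Z c) := by
  refine (Prog.Runs.gate ?_).append ((Prog.Runs.gate ?_).append (Prog.Runs.gate ?_)) <;>
    simp only [Gate.supp_adjoint, Gate.supp_flipIf, Gate.supp_phaseIf, Finset.forall_mem_insert,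
      Finset.forall_mem_union, forall_mem_biUnion, forall_mem_reg, placed, if_true] <;> simp

lemma runs_teleport_lcz {n : G.Part B} (hZ : ¬ Z n) :
    Prog.Runs (oracle O δ Np) (placed D L Z c) [.teleport (lcz n) (.worker n) .coord]
      (placed D L (fun m => Z m ∨ m = n) c) := by
  refine Prog.Runs.single (by simp [Instr.Executable, placed, hZ]) ?_
  funext q
  cases q with
  | lcz m =>
    by_cases h : m = n
    · subst h; simp [Instr.move, placed]
    · simp [Instr.move, placed, h]
  | _ => simp [Instr.move, placed]

/-- The workers inspect their own result registers, so these must be home. The final gate at the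
coordinator reads all the `lcz`, which is why they end up there. -/
lemma runs_zeroCheck {S : Finset (Qubit O δ Np)}
    (hS : ∀ q ∈ S, placed (fun _ => False) (fun _ => False) (fun _ => False) c q = .coord) :
    Prog.Runs (oracle O δ Np)
      (placed (fun _ => False) (fun _ => False) (fun _ => False) c) (zeroCheck O δ Np S)
      (placed (fun _ => False) (fun _ => False) (fun _ => True) c) := by
  have h := Prog.Runs.map_of_nodup (orc := oracle O δ Np) (nodup_all (G.Part B))
    (f := fun n => .teleport (lcz n) (.worker n) .coord)
    (fun Z => placed (fun _ => False) (fun _ => False) Z c) fun Z n => runs_teleport_lcz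
  simp only [mem_all] at h
  refine (((Prog.Runs.gate ?_).append (Prog.Runs.map_gate fun n => ?_)).append h).append
    (Prog.Runs.gate ?_)
  · rw [Gate.supp_flipIf, Finset.forall_mem_insert]
    exact ⟨rfl, hS⟩
  · simp [workerData, placed, Finset.forall_mem_union, forall_mem_reg, -Finset.mem_union]
  · simp [placed, forall_mem_reg]

lemma runs_reflection : Prog.Runs (oracle O δ Np)
    (placed (fun _ => False) (fun _ => False) (fun _ => False) c) (reflection O δ Np)
    (placed (fun _ => False) (fun _ => False) (fun _ => False) c) := by
  have h := runs_zeroCheck (O := O) (δ := δ) (Np := Np) (c := c) (S := coordData O δ Np) (by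
    simp only [coordData, Finset.forall_mem_union, forall_mem_biUnion, forall_mem_reg, placed,
      if_false]
    simp)
  exact (h.append (Prog.Runs.gate (by simp [placed]))).append h.inverse

/-- The inverse preparation sends the results home for the reflection and the preparation brings
them back. Start and end locations agree, which permits iteration. -/
lemma runs_uAA (i : Fin Np) : Prog.Runs (oracle O δ Np)
    (placed (fun _ => False) (fun _ => True) (fun _ => False) c) (uAA O δ Np i)
    (placed (fun _ => False) (fun _ => True) (fun _ => False) c) :=
  (((runs_mark i).append runs_uIni.inverse).append runs_reflection).append runs_uIni

/-! ### Qubits touched by the amplitude amplification operator -/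

/-- The qubits other than the coordinator's estimation qubits and their copies. -/
def NotControl : Qubit O δ Np → Prop
  | est _ | ctl _ _ => False
  | _ => True

lemma notControl_localQPE (n : G.Part B) (j : Fin Np) :
    ∀ i ∈ localQPE O δ Np n j, ∀ q ∈ i.touched (oracle O δ Np), NotControl q := by
  intro i hi
  simp only [localQPE, List.mem_append, List.mem_map, List.mem_flatMap, Prog.mem_repeated,
    List.mem_singleton, List.mem_finRange, true_and] at hi
  rcases hi with (⟨k, rfl⟩ | ⟨k, -, hi⟩) | rfl
  · simp [Instr.touched, NotControl]
  · simp only [Prog.controlBy, localAA, List.map_cons, List.map_nil, List.mem_cons,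
      List.not_mem_nil, or_false] at hi
    rcases hi with rfl | rfl | rfl | rfl <;>
      simp only [Instr.touched, Instr.controlBy, localMark, localTarget, Gate.supp_phaseIf,
        Finset.forall_mem_union, Finset.forall_mem_insert, forall_mem_reg, supp_oracle,
        NotControl] <;> simp
  · simp [Instr.touched, NotControl]

lemma notControl_uMax (n : G.Part B) :
    ∀ i ∈ uMax O δ Np n, ∀ q ∈ i.touched (oracle O δ Np), NotControl q := by
  intro i hi
  simp only [uMax, localTest, List.mem_flatMap, List.mem_append, List.mem_singleton,
    Prog.mem_inverse, List.mem_finRange, true_and] at hi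
  obtain ⟨j, ((((rfl | hi) | rfl) | ⟨i, hi, rfl⟩) | rfl) | rfl⟩ := hi
  · simp only [Instr.touched, Finset.forall_mem_union, forall_mem_reg, supp_oracle, NotControl]
    simp
  · exact notControl_localQPE n j i hi
  · simp only [Instr.touched, Finset.forall_mem_union, Finset.forall_mem_insert,
      Gate.supp_flipIf, forall_mem_reg, NotControl]
    simp
  · rw [Instr.touched_inverse]
    exact notControl_localQPE n j i hi
  · simp only [Instr.touched, Finset.forall_mem_union, forall_mem_reg, supp_oracle, NotControl]
    simp
  · simp only [Instr.touched, Finset.forall_mem_union, Finset.forall_mem_insert,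
      Gate.supp_swapIf, localTarget, forall_mem_reg, NotControl]
    simp

lemma notControl_fanOut (n : G.Part B) :
    ∀ i ∈ fanOut O δ Np n, ∀ q ∈ i.touched (oracle O δ Np), NotControl q := by
  intro i hi
  simp only [fanOut, List.mem_map] at hi
  obtain ⟨v, -, rfl⟩ := hi
  simp [Instr.touched, NotControl]

lemma notControl_uIni :
    ∀ i ∈ uIni O δ Np, ∀ q ∈ i.touched (oracle O δ Np), NotControl q := by
  intro i hi
  simp only [uIni, List.mem_append, List.mem_map, List.mem_flatMap, mem_all, true_and,
    Prog.mem_inverse, List.mem_finRange] at hi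
  rcases hi with (((⟨v, rfl⟩ | ⟨n, hi | ⟨v, rfl⟩⟩) | ⟨n, hi⟩) | ⟨n, ⟨v, rfl⟩ | ⟨j, rfl⟩⟩) |
    ⟨n, i, hi, rfl⟩
  · simp [Instr.touched, NotControl]
  · exact notControl_fanOut n i hi
  · simp [Instr.touched, NotControl]
  · exact notControl_uMax n i hi
  · simp [Instr.touched, NotControl]
  · simp [Instr.touched, NotControl]
  · rw [Instr.touched_inverse]
    exact notControl_fanOut n i hi

lemma notControl_mark (j : Fin Np) :
    ∀ i ∈ mark O δ Np j, ∀ q ∈ i.touched (oracle O δ Np), NotControl q := by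
  intro i hi
  simp only [mark, List.mem_cons, List.not_mem_nil, or_false] at hi
  rcases hi with rfl | rfl | rfl <;>
    simp only [Instr.touched, Finset.forall_mem_union, Finset.forall_mem_insert,
      Gate.supp_adjoint, Gate.supp_flipIf, Gate.supp_phaseIf, forall_mem_biUnion, forall_mem_reg,
      NotControl] <;> simp

/-- The condition on `S` holds for the reflection. The zero check of error mitigation also inspects
the estimation qubits, but it is never run under control. -/
lemma notControl_zeroCheck {S : Finset (Qubit O δ Np)} (hS : ∀ q ∈ S, NotControl q) :
    ∀ i ∈ zeroCheck O δ Np S, ∀ q ∈ i.touched (oracle O δ Np), NotControl q := by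
  intro i hi
  simp only [zeroCheck, List.mem_append, List.mem_map, List.mem_singleton, mem_all,
    true_and] at hi
  rcases hi with ((rfl | ⟨n, rfl⟩) | ⟨n, rfl⟩) | rfl
  · simpa [Instr.touched, NotControl] using hS
  · simp only [Instr.touched, Finset.forall_mem_union, Finset.forall_mem_insert, workerData,
      Gate.supp_flipIf, forall_mem_reg, NotControl]
    simp
  · simp [Instr.touched, NotControl]
  · simp only [Instr.touched, Finset.forall_mem_union, Finset.forall_mem_insert,
      Gate.supp_flipIf, forall_mem_reg, NotControl]
    simp

lemma notControl_reflection :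
    ∀ i ∈ reflection O δ Np, ∀ q ∈ i.touched (oracle O δ Np), NotControl q := by
  have h : ∀ i ∈ zeroCheck O δ Np (coordData O δ Np), ∀ q ∈ i.touched (oracle O δ Np),
      NotControl q := notControl_zeroCheck <| by
    simp only [coordData, Finset.forall_mem_union, forall_mem_biUnion, forall_mem_reg, NotControl]
    simp
  intro i hi
  simp only [reflection, List.mem_append, List.mem_singleton, Prog.mem_inverse] at hi
  rcases hi with (hi | rfl) | ⟨i, hi, rfl⟩
  · exact h i hi
  · simp [Instr.touched, NotControl]
  · rw [Instr.touched_inverse]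
    exact h i hi

/-- This is the disjointness needed to control amplification by `est k` and its copies: controls
already present inside it are `lest` qubits only. -/
lemma notControl_uAA (j : Fin Np) :
    ∀ i ∈ uAA O δ Np j, ∀ q ∈ i.touched (oracle O δ Np), NotControl q := by
  intro i hi
  simp only [uAA, List.mem_append, Prog.mem_inverse] at hi
  rcases hi with ((hi | ⟨i, hi, rfl⟩) | hi) | hi
  · exact notControl_mark j i hi
  · rw [Instr.touched_inverse]
    exact notControl_uIni i hi
  · exact notControl_reflection i hi
  · exact notControl_uIni i hi

/-! ### Phase estimation and the whole algorithm -/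

lemma runs_distribute (k : Fin (tC O δ Np)) :
    Prog.Runs (oracle O δ Np) (placed D L Z fun _ _ => False) (distribute O δ Np k)
      (placed D L Z fun _ j => j = k) := by
  have h := Prog.Runs.flatMap_of_nodup (orc := oracle O δ Np) (nodup_all (G.Part B))
    (f := fun n => [at' O δ Np .coord (.cnot (est k) (ctl n k)),
      .teleport (ctl n k) .coord (.worker n)])
    -- Only the copies of the `k`-th estimation qubit travel; `C` is the set of workers already
    -- served.
    (fun C => placed D L Z fun n j => C n ∧ j = k) (fun C n hn => ?_)
  · simp only [mem_all, true_and, false_and] at h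
    exact h
  · refine (Prog.Runs.gate (by simp [placed, hn])).append
      (Prog.Runs.single (by simp [Instr.Executable, placed, hn]) ?_)
    funext q
    cases q with
    | ctl m j =>
      by_cases hm : m = n
      · subst hm
        by_cases hj : j = k
        · subst hj; simp [Instr.move, placed]
        · simp [Instr.move, placed, hj]
      · simp [Instr.move, placed, hm]
    | _ => simp [Instr.move, placed]

lemma runs_controlledPower (i : Fin Np) (k : Fin (tC O δ Np)) : Prog.Runs (oracle O δ Np)
    (placed (fun _ => False) (fun _ => True) (fun _ => False) fun _ _ => False)
    (controlledPower O δ Np i k)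
    (placed (fun _ => False) (fun _ => True) (fun _ => False) fun _ _ => False) := by
  refine ((runs_distribute k).append (Prog.Runs.repeated ?_ _)).append
    (runs_distribute k).inverse
  -- After the distribution every processor holds its control: `est k` at the coordinator, `ctl n k`
  -- at worker `n`.
  refine (runs_uAA i).controlBy (fun p => ?_) fun j hj p hp => ?_
  · cases p <;> simp [control, placed]
  · have := notControl_uAA i j hj _ hp
    cases p <;> exact this

lemma runs_qpe (i : Fin Np) : Prog.Runs (oracle O δ Np)
    (placed (fun _ => False) (fun _ => True) (fun _ => False) fun _ _ => False) (qpe O δ Np i)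
    (placed (fun _ => False) (fun _ => True) (fun _ => False) fun _ _ => False) := by
  refine Prog.Runs.append (Prog.Runs.append (Prog.Runs.map_gate fun k => ?_)
    (Prog.Runs.flatMap fun k _ => runs_controlledPower i k)) (Prog.Runs.gate ?_) <;>
    simp [placed]

lemma runs_errorMitigation (i : Fin Np) : Prog.Runs (oracle O δ Np)
    (placed (fun _ => False) (fun _ => False) (fun _ => False) fun _ _ => False)
    (errorMitigation O δ Np i)
    (placed (fun _ => False) (fun _ => False) (fun _ => False) fun _ _ => False) := by
  have h := runs_zeroCheck (O := O) (δ := δ) (Np := Np) (c := fun _ _ => False)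
    (S := reg O δ Np est ∪ coordData O δ Np ∪ Finset.univ.biUnion fun n => reg O δ Np (ctl n)) (by
    simp only [coordData, Finset.forall_mem_union, forall_mem_biUnion, forall_mem_reg, placed,
      if_false]
    simp)
  exact (h.append (Prog.Runs.gate (by simp [placed]))).append h.inverse

lemma runs_phaseTest (i : Fin Np) : Prog.Runs (oracle O δ Np)
    (placed (fun _ => False) (fun _ => False) (fun _ => False) fun _ _ => False)
    (phaseTest O δ Np i)
    (placed (fun _ => False) (fun _ => False) (fun _ => False) fun _ _ => False) := by
  refine ((((runs_uIni.append (runs_qpe i)).append (Prog.Runs.gate ?_)).append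
    (runs_qpe i).inverse).append runs_uIni.inverse).append (runs_errorMitigation i)
  simp [placed, forall_mem_reg]

lemma executable_aDist : Prog.Executable (oracle O δ Np) home (aDist O δ Np) := by
  rw [home_eq_placed]
  exact (Prog.Runs.flatMap fun i _ => runs_phaseTest i).1

/-! ### Qubits of the processors -/

/-- The two processors are the coordinator and worker `n`. -/
def Between (n : G.Part B) (s d : Proc (G.Part B)) : Prop :=
  s = .coord ∧ d = .worker n ∨ s = .worker n ∧ d = .coord

lemma between_comm {n : G.Part B} {s d : Proc (G.Part B)} : Between n s d ↔ Between n d s := by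
  unfold Between
  tauto

/-- The qubits that the coordinator exchanges with worker `n`. -/
def Exchanged (n : G.Part B) : Qubit O δ Np → Prop
  | lres m _ | baux m _ | ctl m _ | lcz m => m = n
  | _ => False

variable {q : Qubit O δ Np} {s d : Proc (G.Part B)}

lemma teleport_notMem_fanOut (n : G.Part B) : .teleport q s d ∉ fanOut O δ Np n := by
  simp [fanOut]

lemma teleport_notMem_localQPE (n : G.Part B) (i : Fin Np) :
    .teleport q s d ∉ localQPE O δ Np n i := by
  simp [localQPE, Prog.mem_repeated, Prog.teleport_mem_controlBy, localAA]

lemma teleport_notMem_uMax (n : G.Part B) : .teleport q s d ∉ uMax O δ Np n := by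
  simp [uMax, localTest, Prog.teleport_mem_inverse, teleport_notMem_localQPE]

/-- Results move only towards the coordinator here; the opposite direction comes from the inverse
preparation. -/
lemma teleport_mem_uIni : .teleport q s d ∈ uIni O δ Np ↔
    ∃ n, (∃ v, baux n v = q) ∧ Between n s d ∨
      (∃ i, lres n i = q) ∧ s = .worker n ∧ d = .coord := by
  simp only [uIni, List.mem_append, List.mem_map, List.mem_flatMap, mem_all, true_and,
    teleport_notMem_fanOut, teleport_notMem_uMax, Prog.teleport_mem_inverse, List.mem_finRange,
    reduceCtorEq, exists_false, false_or, or_false, Instr.teleport.injEq, Between]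
  rw [← exists_or]
  refine exists_congr fun n => ?_
  constructor
  · rintro (⟨v, rfl, rfl, rfl⟩ | ⟨v, rfl, rfl, rfl⟩ | ⟨v, rfl, rfl, rfl⟩)
    exacts [Or.inl ⟨⟨v, rfl⟩, Or.inl ⟨rfl, rfl⟩⟩, Or.inl ⟨⟨v, rfl⟩, Or.inr ⟨rfl, rfl⟩⟩,
      Or.inr ⟨⟨v, rfl⟩, rfl, rfl⟩]
  · rintro (⟨⟨v, rfl⟩, ⟨rfl, rfl⟩ | ⟨rfl, rfl⟩⟩ | ⟨⟨v, rfl⟩, rfl, rfl⟩)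
    exacts [Or.inl ⟨v, rfl, rfl, rfl⟩, Or.inr (Or.inl ⟨v, rfl, rfl, rfl⟩),
      Or.inr (Or.inr ⟨v, rfl, rfl, rfl⟩)]

lemma teleport_mem_zeroCheck {S : Finset (Qubit O δ Np)} : .teleport q s d ∈ zeroCheck O δ Np S ↔
    ∃ n, lcz n = q ∧ s = .worker n ∧ d = .coord := by
  simp [zeroCheck, eq_comm (b := s), eq_comm (b := d)]

lemma teleport_mem_distribute {k : Fin (tC O δ Np)} : .teleport q s d ∈ distribute O δ Np k ↔
    ∃ n, ctl n k = q ∧ s = .coord ∧ d = .worker n := by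
  simp [distribute, eq_comm (a := q), eq_comm (a := s), eq_comm (a := d)]

/-- Each block with teleportations occurs together with its inverse, so every exchanged qubit
travels in both directions. -/
lemma teleport_mem_phaseTest (i : Fin Np) : .teleport q s d ∈ phaseTest O δ Np i ↔
    ∃ n, Exchanged n q ∧ Between n s d := by
  simp only [phaseTest, qpe, controlledPower, uAA, mark, reflection, errorMitigation,
    List.mem_append, List.mem_map, List.mem_flatMap, List.mem_cons,
    List.not_mem_nil, Prog.teleport_mem_inverse, Prog.mem_repeated, Prog.teleport_mem_controlBy,
    teleport_mem_uIni, teleport_mem_zeroCheck, teleport_mem_distribute, reduceCtorEq,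
    exists_false, false_or, or_false, and_false, List.mem_finRange, true_and]
  constructor
  · have hu : ∀ {s d}, (∃ n, (∃ v, baux n v = q) ∧ Between n s d ∨
        (∃ i, lres n i = q) ∧ s = .worker n ∧ d = .coord) → ∃ n, Exchanged n q ∧ Between n s d := by
      rintro s d ⟨n, ⟨⟨v, rfl⟩, hb⟩ | ⟨⟨v, rfl⟩, rfl, rfl⟩⟩
      exacts [⟨n, rfl, hb⟩, ⟨n, rfl, Or.inr ⟨rfl, rfl⟩⟩]
    have hz : ∀ {s d}, (∃ n, lcz n = q ∧ s = .worker n ∧ d = .coord) →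
        ∃ n, Exchanged n q ∧ Between n s d := by
      rintro s d ⟨n, rfl, rfl, rfl⟩
      exact ⟨n, rfl, Or.inr ⟨rfl, rfl⟩⟩
    have hd : ∀ {k s d}, (∃ n, ctl n k = q ∧ s = .coord ∧ d = .worker n) →
        ∃ n, Exchanged n q ∧ Between n s d := by
      rintro k s d ⟨n, rfl, rfl, rfl⟩
      exact ⟨n, rfl, Or.inl ⟨rfl, rfl⟩⟩
    have hs : (∃ n, Exchanged n q ∧ Between n d s) → ∃ n, Exchanged n q ∧ Between n s d :=
      fun ⟨n, h, h'⟩ => ⟨n, h, between_comm.1 h'⟩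
    rintro ((((h | ⟨k, (h | ⟨-, (h | h | h) | h⟩) | h⟩) |
      ⟨k, (h | ⟨-, (h | h | h) | h⟩) | h⟩) | h) | h | h)
    all_goals first
      | exact hu h
      | exact hs (hu h)
      | exact hz h
      | exact hs (hz h)
      | exact hd h
      | exact hs (hd h)
  -- No witness is taken from inside amplification, which is absent when the estimation register is
  -- empty. The outer preparation and its inverse serve `baux` and `lres`, the distribution of
  -- controls serves `ctl`, and error mitigation serves `lcz`.
  · rintro ⟨n, hq, h⟩
    cases q with
    | baux m v =>
      obtain rfl : m = n := hq
      exact Or.inl (Or.inl (Or.inl (Or.inl ⟨m, Or.inl ⟨⟨v, rfl⟩, h⟩⟩)))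
    | lres m j =>
      obtain rfl : m = n := hq
      rcases h with ⟨rfl, rfl⟩ | ⟨rfl, rfl⟩
      · exact Or.inl (Or.inr ⟨m, Or.inr ⟨⟨j, rfl⟩, rfl, rfl⟩⟩)
      · exact Or.inl (Or.inl (Or.inl (Or.inl ⟨m, Or.inr ⟨⟨j, rfl⟩, rfl, rfl⟩⟩)))
    | ctl m k =>
      obtain rfl : m = n := hq
      rcases h with ⟨rfl, rfl⟩ | ⟨rfl, rfl⟩
      · exact Or.inl (Or.inl (Or.inl (Or.inr ⟨k, Or.inl (Or.inl ⟨m, rfl, rfl, rfl⟩)⟩)))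
      · exact Or.inl (Or.inl (Or.inl (Or.inr ⟨k, Or.inr ⟨m, rfl, rfl, rfl⟩⟩)))
    | lcz m =>
      obtain rfl : m = n := hq
      rcases h with ⟨rfl, rfl⟩ | ⟨rfl, rfl⟩
      · exact Or.inr (Or.inr ⟨m, rfl, rfl, rfl⟩)
      · exact Or.inr (Or.inl ⟨m, rfl, rfl, rfl⟩)
    | _ => exact hq.elim

lemma exists_teleport_mem_aDist (hNp : 0 < Np) {p : Proc (G.Part B)} :
    (∃ s, .teleport q s p ∈ aDist O δ Np) ↔
      ∃ n, Exchanged n q ∧ (p = .coord ∨ p = .worker n) := by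
  simp only [aDist, List.mem_flatMap, List.mem_finRange, true_and, teleport_mem_phaseTest]
  constructor
  · rintro ⟨s, -, n, hq, h⟩
    exact ⟨n, hq, by unfold Between at h; tauto⟩
  · rintro ⟨n, hq, rfl | rfl⟩
    -- As `Np` is positive there is a phase test, and a single one already exchanges all these
    -- qubits.
    exacts [⟨.worker n, ⟨0, hNp⟩, n, hq, Or.inr ⟨rfl, rfl⟩⟩,
      ⟨.coord, ⟨0, hNp⟩, n, hq, Or.inl ⟨rfl, rfl⟩⟩]

/-- The kinds of qubits. -/
def qubitEquiv : Qubit O δ Np ≃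
    {v : V // v ∈ B} ⊕ Fin (tC O δ Np) ⊕ Fin Np ⊕ Unit ⊕ Unit ⊕ Unit ⊕
      (Σ n : G.Part B, Fin (tW O δ n) ⊕ G.IntVar n ⊕ Fin Np ⊕ G.BdryVar n ⊕ Fin (tC O δ Np) ⊕
        Fin (O.numAnc n) ⊕ Unit) where
  toFun
    | bdry v => .inl v
    | est k => .inr (.inl k)
    | res i => .inr (.inr (.inl i))
    | cz => .inr (.inr (.inr (.inl ())))
    | gz => .inr (.inr (.inr (.inr (.inl ()))))
    | canc => .inr (.inr (.inr (.inr (.inr (.inl ())))))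
    | lest n k => .inr (.inr (.inr (.inr (.inr (.inr ⟨n, .inl k⟩)))))
    | lvar n v => .inr (.inr (.inr (.inr (.inr (.inr ⟨n, .inr (.inl v)⟩)))))
    | lres n i => .inr (.inr (.inr (.inr (.inr (.inr ⟨n, .inr (.inr (.inl i))⟩)))))
    | baux n v => .inr (.inr (.inr (.inr (.inr (.inr ⟨n, .inr (.inr (.inr (.inl v)))⟩)))))
    | ctl n k => .inr (.inr (.inr (.inr (.inr (.inr ⟨n, .inr (.inr (.inr (.inr (.inl k))))⟩)))))
    | anc n j =>
      .inr (.inr (.inr (.inr (.inr (.inr ⟨n, .inr (.inr (.inr (.inr (.inr (.inl j)))))⟩)))))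
    | lcz n =>
      .inr (.inr (.inr (.inr (.inr (.inr ⟨n, .inr (.inr (.inr (.inr (.inr (.inr ())))))⟩)))))
  invFun
    | .inl v => bdry v
    | .inr (.inl k) => est k
    | .inr (.inr (.inl i)) => res i
    | .inr (.inr (.inr (.inl _))) => cz
    | .inr (.inr (.inr (.inr (.inl _)))) => gz
    | .inr (.inr (.inr (.inr (.inr (.inl _))))) => canc
    | .inr (.inr (.inr (.inr (.inr (.inr ⟨n, .inl k⟩))))) => lest n k
    | .inr (.inr (.inr (.inr (.inr (.inr ⟨n, .inr (.inl v)⟩))))) => lvar n v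
    | .inr (.inr (.inr (.inr (.inr (.inr ⟨n, .inr (.inr (.inl i))⟩))))) => lres n i
    | .inr (.inr (.inr (.inr (.inr (.inr ⟨n, .inr (.inr (.inr (.inl v)))⟩))))) => baux n v
    | .inr (.inr (.inr (.inr (.inr (.inr ⟨n, .inr (.inr (.inr (.inr (.inl k))))⟩))))) => ctl n k
    | .inr (.inr (.inr (.inr (.inr (.inr ⟨n, .inr (.inr (.inr (.inr (.inr (.inl j)))))⟩))))) =>
      anc n j
    | .inr (.inr (.inr (.inr (.inr (.inr ⟨n, .inr (.inr (.inr (.inr (.inr (.inr _)))))⟩))))) =>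
      lcz n
  left_inv q := by cases q <;> rfl
  right_inv q := by
    rcases q with _ | _ | _ | _ | _ | _ | ⟨n, _ | _ | _ | _ | _ | _ | _⟩ <;> rfl

instance : Fintype (Qubit O δ Np) := Fintype.ofEquiv _ qubitEquiv.symm

/-- All qubit counts are sums of an indicator over the network; this splits such a sum by register.
-/
lemma sum_qubit (f : Qubit O δ Np → ℕ) : ∑ q, f q =
    ∑ v, f (bdry v) + ∑ k, f (est k) + ∑ i, f (res i) + f cz + f gz + f canc +
      ∑ n, (∑ k, f (lest n k) + ∑ v, f (lvar n v) + ∑ i, f (lres n i) + ∑ v, f (baux n v) +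
        ∑ k, f (ctl n k) + ∑ j, f (anc n j) + f (lcz n)) := by
  rw [← qubitEquiv.symm.sum_comp f]
  simp only [Fintype.sum_sum_type, Fintype.sum_sigma, Finset.univ_unique, Finset.sum_singleton,
    ← add_assoc]
  rfl

lemma totalQubits_eq : totalQubits O δ Np =
    B.card + (Np + tC O δ Np) + (∑ n, (Np + tW O δ n + Nat.card (G.IntVar n))) +
      (3 + ∑ n, (Nat.card (G.BdryVar n) + O.numAnc n + tC O δ Np + 1)) := by
  rw [totalQubits, Nat.card_eq_fintype_card, Fintype.card_eq_sum_ones, sum_qubit]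
  simp only [Finset.sum_const, Finset.card_univ, Fintype.card_coe, Fintype.card_fin,
    smul_eq_mul, mul_one, Nat.card_eq_fintype_card, Finset.sum_add_distrib]
  ring

lemma qubitsAt_aDist (hNp : 0 < Np) (p : Proc (G.Part B)) :
    Prog.qubitsAt home (aDist O δ Np) p =
      ∑ q : Qubit O δ Np,
        if home q = p ∨ ∃ n, Exchanged n q ∧ (p = .coord ∨ p = .worker n) then 1 else 0 := by
  rw [Prog.qubitsAt_eq, Finset.sum_boole, Nat.cast_id, ← Set.ncard_coe_finset]
  congr 1
  ext q
  simp [exists_teleport_mem_aDist hNp]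

/-- Boundary copies and control copies start at the coordinator. Of the exchanged qubits only `lres`
and `lcz` are new to it, `Np + 1` per worker. -/
lemma qubitsAt_coord (hNp : 0 < Np) : Prog.qubitsAt home (aDist O δ Np) .coord =
    B.card + tC O δ Np + Np + G.numParts B * (Np + 1) +
      (∑ n : G.Part B, Nat.card (G.BdryVar n)) + G.numParts B * tC O δ Np + 3 := by
  rw [qubitsAt_aDist hNp, sum_qubit]
  simp only [home, Exchanged, reduceCtorEq, or_false, and_true, exists_eq',
    exists_false, if_true, if_false, Finset.sum_const, Finset.card_univ, Fintype.card_coe,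
    Fintype.card_fin, smul_eq_mul, mul_one, Nat.card_eq_fintype_card, Finset.sum_add_distrib,
    or_true, mul_zero, FactorGraph.numParts]
  ring

lemma qubitsAt_worker (hNp : 0 < Np) (n : G.Part B) :
    Prog.qubitsAt home (aDist O δ Np) (.worker n) =
      Nat.card (G.IntVar n) + Nat.card (G.BdryVar n) + Np + tW O δ n + O.numAnc n +
        tC O δ Np + 1 := by
  rw [qubitsAt_aDist hNp, sum_qubit]
  simp only [home, Exchanged, reduceCtorEq, false_or, Proc.worker.injEq, exists_eq_right',
    exists_false, false_and, or_false, or_self, if_false, Finset.sum_const, Finset.card_univ,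
    Fintype.card_fin, smul_eq_mul, Nat.card_eq_fintype_card, Finset.sum_add_distrib, mul_zero,
    Finset.sum_ite_eq', Finset.mem_univ, if_true, mul_ite, mul_one]
  ring

/-! ### Oracle queries and EPR pairs -/

/-- The form with `+ 1` avoids truncated subtraction in the counts below. -/
lemma sum_two_pow_add_one (t : ℕ) : ∑ k : Fin t, 2 ^ (k : ℕ) + 1 = 2 ^ t := by
  induction t with
  | zero => simp
  | succ t ih => rw [Fin.sum_univ_castSucc]; simp only [Fin.val_castSucc, Fin.val_last]; omega

/-- The cost of the algorithm for a weight that vanishes on gates and does not change under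
inversion and control. -/
lemma cost_aDist {w : Instr (Qubit O δ Np) (G.Part B) → ℕ} (hg : ∀ p c g, w (.gate p c g) = 0)
    (hi : ∀ i, w i.inverse = w i) (hc : ∀ κ i, w (i.controlBy κ) = w i) {z e : ℕ}
    (hz : ∀ S, Prog.cost w (zeroCheck O δ Np S) = z)
    (he : ∀ k, Prog.cost w (distribute O δ Np k) = e) :
    Prog.cost w (aDist O δ Np) =
      Np * (2 ^ (tC O δ Np + 2) - 2) * Prog.cost w (uIni O δ Np) +
        Np * (2 ^ (tC O δ Np + 2) - 4) * z + Np * tC O δ Np * (2 * e) +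
        (Np * tC O δ Np * (2 * e) + Np * (2 * z)) := by
  -- One amplification contains the preparation and its inverse, and inside the reflection a zero
  -- check and its inverse.
  have hA : ∀ i, Prog.cost w (uAA O δ Np i) = 2 * Prog.cost w (uIni O δ Np) + 2 * z := by
    intro i
    simp only [uAA, mark, reflection, Prog.cost_append, Prog.cost_cons, Prog.cost_nil, hg,
      Prog.cost_inverse hi, hz]
    ring
  have hQ : ∀ i, Prog.cost w (qpe O δ Np i) = tC O δ Np * (2 * e) +
      (∑ k : Fin (tC O δ Np), 2 ^ (k : ℕ)) * (2 * Prog.cost w (uIni O δ Np) + 2 * z) := by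
    intro i
    simp only [qpe, controlledPower, Prog.cost_append, Prog.cost_cons, Prog.cost_nil,
      Prog.cost_map, Prog.cost_flatMap, Prog.cost_repeated, Prog.cost_controlBy (hc _),
      Prog.cost_inverse hi, hg, hA, he, ← Fin.sum_univ_def, Finset.sum_add_distrib,
      ← Finset.sum_mul, Finset.sum_const, Finset.card_univ, Fintype.card_fin, smul_eq_mul]
    ring
  have hP : ∀ i, Prog.cost w (phaseTest O δ Np i) =
      2 * Prog.cost w (uIni O δ Np) + 2 * Prog.cost w (qpe O δ Np i) + 2 * z := by
    intro i
    simp only [phaseTest, errorMitigation, Prog.cost_append, Prog.cost_cons, Prog.cost_nil, hg,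
      Prog.cost_inverse hi, hz]
    ring
  simp only [aDist, Prog.cost_flatMap, ← Fin.sum_univ_def, hP, hQ, Finset.sum_const,
    Finset.card_univ, Fintype.card_fin, smul_eq_mul]
  -- With `m = 2 ^ t - 1` the truncated differences become the honest naturals `4 * m + 2` and `4 *
  -- m`, and the identity is polynomial.
  obtain ⟨m, hm⟩ : ∃ m, m = ∑ k : Fin (tC O δ Np), 2 ^ (k : ℕ) := ⟨_, rfl⟩
  have h₂ : 2 ^ (tC O δ Np + 2) - 2 = 4 * m + 2 := by
    rw [pow_add, ← sum_two_pow_add_one, ← hm]; omega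
  have h₄ : 2 ^ (tC O δ Np + 2) - 4 = 4 * m := by
    rw [pow_add, ← sum_two_pow_add_one, ← hm]; omega
  rw [h₂, h₄, ← hm]
  ring

/-- Same count one level down: each local amplification makes two queries, and the outer leaf oracle
and its inverse add two more to each test. -/
lemma queries_uMax (n : G.Part B) :
    Prog.cost Instr.queries (uMax O δ Np n) = Np * (2 ^ (tW O δ n + 2) - 2) := by
  have hQ : ∀ i, Prog.cost Instr.queries (localQPE O δ Np n i) =
      (∑ k : Fin (tW O δ n), 2 ^ (k : ℕ)) * 2 := by
    intro i
    simp only [localQPE, localAA, Prog.cost_append, Prog.cost_cons, Prog.cost_nil, Prog.cost_map,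
      Prog.cost_flatMap, Prog.cost_repeated, Prog.cost_controlBy (Instr.queries_controlBy _),
      Instr.queries, ← Fin.sum_univ_def, ← Finset.sum_mul, Finset.sum_const_zero]
    ring
  simp only [uMax, localTest, Prog.cost_append, Prog.cost_cons, Prog.cost_nil, Prog.cost_flatMap,
    Prog.cost_inverse Instr.queries_inverse, hQ, Instr.queries, ← Fin.sum_univ_def,
    Finset.sum_const, Finset.card_univ, Fintype.card_fin, smul_eq_mul]
  obtain ⟨m, hm⟩ : ∃ m, m = ∑ k : Fin (tW O δ n), 2 ^ (k : ℕ) := ⟨_, rfl⟩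
  have h₂ : 2 ^ (tW O δ n + 2) - 2 = 4 * m + 2 := by
    rw [pow_add, ← sum_two_pow_add_one, ← hm]; omega
  rw [h₂, ← hm]
  ring

lemma queries_uIni : Prog.cost Instr.queries (uIni O δ Np) =
    Np * ∑ n : G.Part B, (2 ^ (tW O δ n + 2) - 2) := by
  simp only [uIni, fanOut, Prog.cost_append, Prog.cost_map, Prog.cost_flatMap, queries_uMax,
    Prog.cost_inverse Instr.queries_inverse, Instr.queries, sum_map_all, List.map_const',
    List.sum_replicate, smul_zero, Finset.mul_sum]
  simp

lemma queries_aDist : Prog.queries (aDist O δ Np) =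
    Np ^ 2 * (2 ^ (tC O δ Np + 2) - 2) * ∑ n : G.Part B, (2 ^ (tW O δ n + 2) - 2) := by
  -- Zero checks and the distribution of controls query no oracle, so both parameters are zero.
  have h := cost_aDist (O := O) (δ := δ) (Np := Np) (w := Instr.queries) (z := 0) (e := 0)
    (fun _ _ _ => rfl) Instr.queries_inverse Instr.queries_controlBy
    (fun S => by
      simp only [zeroCheck, Prog.cost_append, Prog.cost_map, Prog.cost_cons, Prog.cost_nil,
        Instr.queries, sum_map_all, Finset.sum_const_zero, add_zero])
    (fun k => by
      simp only [distribute, Prog.cost_flatMap, Prog.cost_cons, Prog.cost_nil, Instr.queries,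
        sum_map_all, add_zero, Finset.sum_const_zero])
  change Prog.cost Instr.queries (aDist O δ Np) = _
  rw [h, queries_uIni]
  ring

lemma eprPairs_aDist {N : SimpleGraph (Proc (G.Part B))} (hN : ∀ n, N.Adj .coord (.worker n)) :
    Prog.eprPairs N (aDist O δ Np) =
      Np * (2 ^ (tC O δ Np + 2) - 2) * (∑ n : G.Part B, (2 * Nat.card (G.BdryVar n) + Np)) +
        Np * (2 ^ (tC O δ Np + 2) - 4) * G.numParts B +
        Np * tC O δ Np * (2 * G.numParts B) +
        (Np * tC O δ Np * (2 * G.numParts B) + Np * (2 * G.numParts B)) := by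
  have d₁ : ∀ n, N.dist .coord (.worker n) = 1 := fun n => SimpleGraph.dist_eq_one_iff_adj.2 (hN n)
  have d₂ : ∀ n, N.dist (.worker n) .coord = 1 := fun n => SimpleGraph.dist_comm.trans (d₁ n)
  have hQ : ∀ n i, Prog.cost (Instr.eprPairs N) (localQPE O δ Np n i) = 0 := by
    intro n i
    simp only [localQPE, localAA, Prog.cost_append, Prog.cost_cons, Prog.cost_nil, Prog.cost_map,
      Prog.cost_flatMap, Prog.cost_repeated, Prog.cost_controlBy (Instr.eprPairs_controlBy N _),
      Instr.eprPairs, ← Fin.sum_univ_def, add_zero, mul_zero, Finset.sum_const_zero]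
  have hM : ∀ n, Prog.cost (Instr.eprPairs N) (uMax O δ Np n) = 0 := by
    intro n
    simp only [uMax, localTest, Prog.cost_append, Prog.cost_cons, Prog.cost_nil,
      Prog.cost_flatMap, Prog.cost_inverse (Instr.eprPairs_inverse N), hQ, Instr.eprPairs,
      ← Fin.sum_univ_def, add_zero, Finset.sum_const_zero]
  have hU : Prog.cost (Instr.eprPairs N) (uIni O δ Np) =
      ∑ n : G.Part B, (2 * Nat.card (G.BdryVar n) + Np) := by
    simp only [uIni, fanOut, Prog.cost_append, Prog.cost_map, Prog.cost_flatMap, hM,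
      Prog.cost_inverse (Instr.eprPairs_inverse N), Instr.eprPairs, d₁, d₂, sum_map_all,
      List.map_const', List.sum_replicate, length_all, List.length_finRange, smul_eq_mul,
      mul_one, mul_zero, Finset.sum_const_zero, Finset.sum_add_distrib, ← Finset.mul_sum]
    ring
  -- A zero check and a distribution each teleport one qubit per worker over a single link.
  have h := cost_aDist (O := O) (δ := δ) (Np := Np) (w := Instr.eprPairs N)
    (z := G.numParts B) (e := G.numParts B)
    (fun _ _ _ => rfl) (Instr.eprPairs_inverse N) (Instr.eprPairs_controlBy N)
    (fun S => by
      simp only [zeroCheck, Prog.cost_append, Prog.cost_map, Prog.cost_cons, Prog.cost_nil,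
        Instr.eprPairs, d₂, sum_map_all, Finset.sum_const, Finset.card_univ, smul_eq_mul,
        mul_one, mul_zero, add_zero, zero_add])
    (fun k => by
      simp only [distribute, Prog.cost_flatMap, Prog.cost_cons, Prog.cost_nil, Instr.eprPairs,
        d₁, sum_map_all, add_zero, zero_add, Finset.sum_const, Finset.card_univ, smul_eq_mul,
        mul_one])
  rw [hU] at h
  exact h

end Algorithm

/-! ## Bounds -/

lemma estSize_le {c δ : ℝ} (hc : 0 < c) (hc' : c ≤ 1) (hδ : 0 < δ) (hδ' : δ < 1) :
    (estSize c δ : ℝ) ≤ -(1 / 2) * Real.logb 2 (δ * c) + 1 := by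
  have h : Real.logb 2 (δ * c) ≤ 0 :=
    Real.logb_nonpos one_lt_two (by positivity) (mul_le_one₀ hδ'.le hc.le hc')
  -- Dropping the `- 1 / 2` leaves a nonnegative argument, as the strict ceiling bound requires.
  have h₁ : estSize c δ ≤ ⌈-(1 / 2) * Real.logb 2 (δ * c)⌉₊ := Nat.ceil_mono (by linarith)
  have h₂ := Nat.ceil_lt_add_one (a := -(1 / 2) * Real.logb 2 (δ * c)) (by linarith)
  exact (Nat.cast_le.2 h₁).trans h₂.le

lemma two_pow_estSize_le {c δ : ℝ} (hc : 0 < c) (hc' : c ≤ 1) (hδ : 0 < δ) (hδ' : δ < 1) :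
    (2 : ℝ) ^ estSize c δ ≤ 2 / (Real.sqrt δ * Real.sqrt c) := by
  calc (2 : ℝ) ^ estSize c δ = 2 ^ (estSize c δ : ℝ) := (Real.rpow_natCast _ _).symm
    _ ≤ 2 ^ (Real.logb 2 (δ * c) * -(1 / 2) + 1) :=
        Real.rpow_le_rpow_of_exponent_le one_le_two
          ((estSize_le hc hc' hδ hδ').trans_eq (by ring))
    _ = 2 / (Real.sqrt δ * Real.sqrt c) := by
        rw [Real.rpow_add two_pos, Real.rpow_mul two_pos.le,
          Real.rpow_logb two_pos (by norm_num) (by positivity), Real.rpow_one,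
          Real.rpow_neg (by positivity), ← Real.sqrt_eq_rpow, Real.sqrt_mul hδ.le]
        field_simp

/-! ### Explicit bounds on register sizes and resources. -/

section Algorithm

variable {V : Type*} {F : Type*} [Fintype V] [Fintype F] {G : FactorGraph V F} {B : Finset V}
  {O : G.LocalOracles B} {δ : ℝ} {Np : ℕ}

/-- A column of a unitary matrix has norm one, and the overlap is part of the squared norm of the
all-zero column. Any boundary configuration serves. -/
lemma pmin_le_one (O : G.LocalOracles B) (n : G.Part B) : O.pmin n ≤ 1 := by
  have h : ∑ s, ‖O.U n (fun _ => false) s (fun _ => false, fun _ => false)‖ ^ 2 = 1 := by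
    have h := congrFun (congrFun (Matrix.mem_unitaryGroup_iff'.1 (O.unitary n fun _ => false))
      (fun _ => false, fun _ => false)) (fun _ => false, fun _ => false)
    rw [Matrix.mul_apply, Matrix.one_apply_eq] at h
    simp only [Matrix.star_apply, RCLike.star_def, Complex.conj_mul'] at h
    exact_mod_cast h
  refine (O.overlap n fun _ => false).trans (le_of_le_of_eq (Finset.sum_le_sum fun s _ => ?_) h)
  split_ifs
  exacts [le_rfl, by positivity]

lemma numBdryConfigs_eq (G : FactorGraph V F) (B : Finset V) :
    G.numBdryConfigs B = 2 ^ B.card := by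
  simp [FactorGraph.numBdryConfigs]

/-- Choose a variable node in each subgraph; it determines its component. -/
lemma numParts_le (G : FactorGraph V F) (B : Finset V) : G.numParts B ≤ Fintype.card V := by
  refine Fintype.card_le_of_injective (fun n : G.Part B => n.2.choose.1) fun m n h => ?_
  exact Subtype.ext (m.2.choose_spec.symm.trans
    ((congrArg _ (congrArg _ (Subtype.ext h))).trans n.2.choose_spec))

lemma card_bdryVar_le (n : G.Part B) : Nat.card (G.BdryVar n) ≤ Fintype.card V := by
  rw [Nat.card_eq_fintype_card]
  exact Fintype.card_subtype_le _

lemma pminC_pos (hδ' : δ < 1) : 0 < pminC O δ Np := by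
  have : 0 < 1 - δ := by linarith
  have : (0 : ℝ) < G.numBdryConfigs B := by rw [numBdryConfigs_eq]; positivity
  unfold pminC
  positivity

lemma pminC_le_one (hδ : 0 < δ) (hδ' : δ < 1) : pminC O δ Np ≤ 1 := by
  have h : (1 : ℝ) ≤ G.numBdryConfigs B := by
    rw [numBdryConfigs_eq]
    exact_mod_cast Nat.one_le_two_pow
  rw [pminC, div_le_one (by linarith)]
  exact (pow_le_one₀ (by linarith) (by linarith)).trans h

lemma two_pow_tC_le (hδ : 0 < δ) (hδ' : δ < 1) : (2 : ℝ) ^ tC O δ Np ≤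
    2 / Real.sqrt δ * (((1 - δ) ^ (Np * G.numParts B))⁻¹ * Real.sqrt (G.numBdryConfigs B)) := by
  have h₁ : 0 < 1 - δ := by linarith
  refine (two_pow_estSize_le (pminC_pos hδ') (pminC_le_one hδ hδ') hδ hδ').trans_eq ?_
  have h : Real.sqrt (pminC O δ Np) =
      (1 - δ) ^ (Np * G.numParts B) / Real.sqrt (G.numBdryConfigs B) := by
    rw [pminC, Real.sqrt_div (by positivity),
      show 2 * Np * G.numParts B = Np * G.numParts B * 2 by ring, pow_mul,
      Real.sqrt_sq (by positivity)]
  rw [h]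
  field_simp

/-- Taking logarithms of `pminC` separates the contributions of `δ`, of `1 - δ` and of the boundary.
-/
lemma tC_le (hδ : 0 < δ) (hδ' : δ < 1) : (tC O δ Np : ℝ) ≤
    Real.log (1 / δ) + 2 * (Np * G.numParts B) * Real.log (1 / (1 - δ)) + B.card + 1 := by
  have h₁ : 0 < 1 - δ := by linarith
  -- This makes the divisor `2 * Real.log 2` exceed one, so base two can be replaced by natural
  -- logarithms.
  have hl : 1 / 2 < Real.log 2 := by linarith [Real.log_two_gt_d9]
  refine (estSize_le (pminC_pos hδ') (pminC_le_one hδ hδ') hδ hδ').trans ?_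
  have ha : 0 ≤ Real.log (1 / δ) := Real.log_nonneg (by rw [le_div_iff₀ hδ]; linarith)
  have hb : 0 ≤ Real.log (1 / (1 - δ)) := Real.log_nonneg (by rw [le_div_iff₀ h₁]; linarith)
  have h : -Real.log (δ * pminC O δ Np) =
      Real.log (1 / δ) + 2 * (Np * G.numParts B) * Real.log (1 / (1 - δ)) +
        B.card * Real.log 2 := by
    rw [Real.log_mul hδ.ne' (pminC_pos hδ').ne', pminC, numBdryConfigs_eq, Nat.cast_pow,
      Real.log_div (by positivity) (by positivity), Real.log_pow, Real.log_pow, one_div, one_div,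
      Real.log_inv, Real.log_inv]
    push_cast
    ring
  have h' : -(1 / 2) * Real.logb 2 (δ * pminC O δ Np) =
      -Real.log (δ * pminC O δ Np) / (2 * Real.log 2) := by
    rw [Real.logb]
    field_simp
  rw [h', h]
  gcongr
  rw [div_le_iff₀ (by linarith)]
  have hx : 0 ≤ Real.log (1 / δ) + 2 * (Np * G.numParts B) * Real.log (1 / (1 - δ)) := by
    positivity
  have hB : (0 : ℝ) ≤ B.card * Real.log 2 := by positivity
  nlinarith [mul_nonneg hx (by linarith : 0 ≤ 2 * Real.log 2 - 1)]

lemma qubitsAt_coord_le (hδ : 0 < δ) (hδ' : δ < 1) (hNp : 0 < Np) (hG : Nonempty (G.Part B)) :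
    (Prog.qubitsAt Qubit.home (aDist O δ Np) .coord : ℝ) ≤
      100 * G.numParts B * (Fintype.card V +
        Np * G.numParts B * (1 + Real.log (1 / δ) + Real.log (1 / (1 - δ)))) := by
  have h₁ : 0 < 1 - δ := by linarith
  have ha : 0 ≤ Real.log (1 / δ) := Real.log_nonneg (by rw [le_div_iff₀ hδ]; linarith)
  have hb : 0 ≤ Real.log (1 / (1 - δ)) := Real.log_nonneg (by rw [le_div_iff₀ h₁]; linarith)
  have ht := tC_le (O := O) (Np := Np) hδ hδ'
  have hS : ((∑ n : G.Part B, Nat.card (G.BdryVar n) : ℕ) : ℝ) ≤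
      G.numParts B * Fintype.card V := by
    have := Finset.sum_le_card_nsmul Finset.univ _ _ fun (n : G.Part B) _ => card_bdryVar_le n
    exact_mod_cast this
  have hB : (B.card : ℝ) ≤ Fintype.card V := by exact_mod_cast Finset.card_le_univ B
  have hv : (0 : ℝ) ≤ Fintype.card V := Nat.cast_nonneg _
  have hg : (1 : ℝ) ≤ G.numParts B := by exact_mod_cast Fintype.card_pos
  have hn : (1 : ℝ) ≤ Np := by exact_mod_cast hNp
  rw [qubitsAt_coord hNp]
  push_cast at hS ⊢
  -- With `r = n g (1 + x + y)`, the register size is at most `2r + v`, and every term of the count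
  -- is bounded by a multiple of `g v` or `g r`.
  generalize (G.numParts B : ℝ) = g at *
  generalize (Np : ℝ) = n at *
  generalize (Fintype.card V : ℝ) = v at *
  generalize (B.card : ℝ) = b at *
  generalize (tC O δ Np : ℝ) = t at *
  generalize Real.log (1 / δ) = x at *
  generalize Real.log (1 / (1 - δ)) = y at *
  generalize ∑ n : G.Part B, (Nat.card (G.BdryVar n) : ℝ) = s at *
  have hgn : 1 ≤ n * g := one_le_mul_of_one_le_of_one_le hn hg
  have h₂ : t ≤ n * g * (1 + x + y) * 2 + v := by
    nlinarith [mul_nonneg (sub_nonneg.2 hgn) ha]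
  have h₃ : n * g ≤ n * g * (1 + x + y) := le_mul_of_one_le_right (by linarith) (by linarith)
  have h₄ : n ≤ n * g := le_mul_of_one_le_right (by linarith) hg
  have h₅ : g ≤ n * g := le_mul_of_one_le_left (by linarith) hn
  generalize n * g * (1 + x + y) = r at *
  have h₆ : g * t ≤ g * (2 * r + v) := by
    gcongr
    linarith
  have h₇ : r ≤ g * r := le_mul_of_one_le_left (by linarith) hg
  have h₈ : v ≤ g * v := le_mul_of_one_le_left hv hg
  nlinarith

lemma card_sub_two_le (t : ℕ) : ((2 ^ (t + 2) - 2 : ℕ) : ℝ) ≤ 4 * 2 ^ t := by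
  have : 2 ^ (t + 2) - 2 ≤ 4 * 2 ^ t := by rw [pow_add]; omega
  exact_mod_cast this

lemma queries_aDist_le (hδ : 0 < δ) (hδ' : δ < 1) :
    (Prog.queries (aDist O δ Np) : ℝ) ≤
      100 / δ * (Np ^ 2 * ((1 - δ) ^ (Np * G.numParts B))⁻¹ *
        ∑ n, Real.sqrt (G.numBdryConfigs B / O.pmin n)) := by
  have h₁ : 0 < 1 - δ := by linarith
  have hW : ((∑ n : G.Part B, (2 ^ (tW O δ n + 2) - 2) : ℕ) : ℝ) ≤
      ∑ n, 8 / (Real.sqrt δ * Real.sqrt (O.pmin n)) := by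
    rw [Nat.cast_sum]
    refine Finset.sum_le_sum fun n _ => (card_sub_two_le _).trans ?_
    calc 4 * (2 : ℝ) ^ tW O δ n ≤ 4 * (2 / (Real.sqrt δ * Real.sqrt (O.pmin n))) := by
          gcongr
          exact two_pow_estSize_le (O.pmin_pos n) (pmin_le_one O n) hδ hδ'
      _ = _ := by ring
  have hC := (card_sub_two_le (tC O δ Np)).trans
    (mul_le_mul_of_nonneg_left (two_pow_tC_le (O := O) (Np := Np) hδ hδ') zero_le_four)
  rw [queries_aDist, Nat.cast_mul, Nat.cast_mul, Nat.cast_pow]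
  calc _ ≤ (Np : ℝ) ^ 2 * (4 * (2 / Real.sqrt δ * (((1 - δ) ^ (Np * G.numParts B))⁻¹ *
        Real.sqrt (G.numBdryConfigs B)))) *
        ∑ n, 8 / (Real.sqrt δ * Real.sqrt (O.pmin n)) := by gcongr
    -- Each level contributes `4 * 2 / √δ`; the two levels together give `64 / δ`.
    _ = 64 / δ * (Np ^ 2 * ((1 - δ) ^ (Np * G.numParts B))⁻¹ *
        ∑ n, Real.sqrt (G.numBdryConfigs B / O.pmin n)) := by
      simp only [Real.sqrt_div (Nat.cast_nonneg _), Finset.mul_sum]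
      refine Finset.sum_congr rfl fun n _ => ?_
      have hs := Real.sqrt_pos.2 hδ
      have hp := Real.sqrt_pos.2 (O.pmin_pos n)
      have hδs : δ = Real.sqrt δ * Real.sqrt δ := (Real.mul_self_sqrt hδ.le).symm
      calc _ = 64 / (Real.sqrt δ * Real.sqrt δ) * (Np ^ 2 * ((1 - δ) ^ (Np * G.numParts B))⁻¹ *
            (Real.sqrt (G.numBdryConfigs B) / Real.sqrt (O.pmin n))) := by field_simp; ring
        _ = _ := by rw [← hδs]
    _ ≤ _ := by
      gcongr
      norm_num

lemma queries_aDist_le_of_pmin (hδ : 0 < δ) (hδ' : δ < 1)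
    (h : ∀ n, 1 / (Nat.card (G.IntVar n → Bool) : ℝ) ≤ O.pmin n) :
    (Prog.queries (aDist O δ Np) : ℝ) ≤
      100 / δ * (Np ^ 2 * ((1 - δ) ^ (Np * G.numParts B))⁻¹ *
        ∑ n : G.Part B, Real.sqrt (G.numBdryConfigs B * Nat.card (G.IntVar n → Bool))) := by
  have h₁ : 0 < 1 - δ := by linarith
  refine (queries_aDist_le hδ hδ').trans ?_
  gcongr with n
  rw [div_eq_mul_inv]
  gcongr
  have hX : (0 : ℝ) < Nat.card (G.IntVar n → Bool) := by exact_mod_cast Nat.card_pos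
  rw [inv_le_comm₀ (O.pmin_pos n) hX, ← one_div]
  exact h n

lemma eprPairs_aDist_le (hδ : 0 < δ) (hδ' : δ < 1) (hNp : 0 < Np) (hG : Nonempty (G.Part B))
    {N : SimpleGraph (Proc (G.Part B))} (hN : ∀ n, N.Adj .coord (.worker n)) :
    (Prog.eprPairs N (aDist O δ Np) : ℝ) ≤
      100 / Real.sqrt δ * (G.numParts B + Np) *
        (Np * ((1 - δ) ^ (Np * G.numParts B))⁻¹ * Fintype.card V *
          Real.sqrt (G.numBdryConfigs B)) := by
  have h₁ : 0 < 1 - δ := by linarith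
  have hE : Prog.eprPairs N (aDist O δ Np) ≤
      18 * (Np * 2 ^ tC O δ Np * (Fintype.card V * (G.numParts B + Np))) := by
    rw [eprPairs_aDist hN]
    have hS := Finset.sum_le_card_nsmul Finset.univ (fun n => 2 * Nat.card (G.BdryVar n) + Np)
      (2 * Fintype.card V + Np) fun (n : G.Part B) _ => by
        have := card_bdryVar_le n
        omega
    have hg : 1 ≤ G.numParts B := Fintype.card_pos
    have hv := numParts_le G B
    have ht : tC O δ Np ≤ 2 ^ tC O δ Np := Nat.lt_two_pow_self.le
    have ht' : 1 ≤ 2 ^ tC O δ Np := Nat.one_le_two_pow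
    have e₂ : 2 ^ (tC O δ Np + 2) - 2 ≤ 4 * 2 ^ tC O δ Np := by rw [pow_add]; omega
    have e₄ : 2 ^ (tC O δ Np + 2) - 4 ≤ 4 * 2 ^ tC O δ Np := by rw [pow_add]; omega
    rw [Finset.card_univ, smul_eq_mul] at hS
    change _ ≤ G.numParts B * _ at hS
    generalize 2 ^ (tC O δ Np + 2) - 2 = m₂ at *
    generalize 2 ^ (tC O δ Np + 2) - 4 = m₄ at *
    generalize 2 ^ tC O δ Np = P at *
    generalize tC O δ Np = t at *
    generalize ∑ n : G.Part B, (2 * Nat.card (G.BdryVar n) + Np) = s at *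
    generalize G.numParts B = g at *
    generalize Fintype.card V = v at *
    have hs : s ≤ 2 * (v * (g + Np)) := hS.trans (by nlinarith)
    have hgv : g ≤ v * (g + Np) := by nlinarith
    -- From `s ≤ 2x`, `g ≤ x`, `t ≤ P` and `1 ≤ P`, the five terms contribute `8 + 4 + 2 + 2 + 2 =
    -- 18`.
    generalize v * (g + Np) = x at *
    calc _ ≤ Np * (4 * P) * (2 * x) + Np * (4 * P) * x + Np * P * (2 * x) +
          (Np * P * (2 * x) + Np * (2 * (P * x))) := by
          gcongr
          nlinarith
      _ = 18 * (Np * P * x) := by ring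
  calc (Prog.eprPairs N (aDist O δ Np) : ℝ)
      ≤ 18 * (Np * 2 ^ tC O δ Np * (Fintype.card V * (G.numParts B + Np))) := by
        exact_mod_cast hE
    _ ≤ 18 * (Np * (2 / Real.sqrt δ * (((1 - δ) ^ (Np * G.numParts B))⁻¹ *
          Real.sqrt (G.numBdryConfigs B))) * (Fintype.card V * (G.numParts B + Np))) := by
        gcongr
        exact two_pow_tC_le hδ hδ'
    _ = 36 / Real.sqrt δ * (G.numParts B + Np) *
        (Np * ((1 - δ) ^ (Np * G.numParts B))⁻¹ * Fintype.card V *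
          Real.sqrt (G.numBdryConfigs B)) := by ring
    _ ≤ _ := by
      gcongr
      norm_num

end Algorithm

end DistQ

end

open DistQ in
theorem mainTheorem2 :
    ∃ C : ℝ, 0 < C ∧
    ∀ (V : Type*) (F : Type*) [Fintype V] [Fintype F] (G : FactorGraph V F) (B : Finset V)
      (O : G.LocalOracles B) (δ : ℝ) (Np : ℕ),
      0 < δ → δ < 1 → 0 < Np → Nonempty (G.Part B) →
      -- the algorithm consists of local operations and teleportations
      Prog.Executable (oracle O δ Np) Qubit.home (aDist O δ Np) ∧
      -- total number of qubits
      totalQubits O δ Np =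
        B.card + (Np + tC O δ Np) + (∑ n, (Np + tW O δ n + Nat.card (G.IntVar n))) +
          (3 + ∑ n, (Nat.card (G.BdryVar n) + O.numAnc n + tC O δ Np + 1)) ∧
      -- qubits of the coordinator
      Prog.qubitsAt Qubit.home (aDist O δ Np) .coord =
        B.card + tC O δ Np + Np + G.numParts B * (Np + 1) +
          (∑ n : G.Part B, Nat.card (G.BdryVar n)) + G.numParts B * tC O δ Np + 3 ∧
      (Prog.qubitsAt Qubit.home (aDist O δ Np) .coord : ℝ) ≤
        C * G.numParts B * (Fintype.card V +
          Np * G.numParts B * (1 + Real.log (1 / δ) + Real.log (1 / (1 - δ)))) ∧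
      -- qubits of the workers
      (∀ n : G.Part B, Prog.qubitsAt Qubit.home (aDist O δ Np) (.worker n) =
        Nat.card (G.IntVar n) + Nat.card (G.BdryVar n) + Np + tW O δ n + O.numAnc n +
          tC O δ Np + 1) ∧
      -- queries to the leaf oracles
      Prog.queries (aDist O δ Np) =
        Np ^ 2 * (2 ^ (tC O δ Np + 2) - 2) * ∑ n : G.Part B, (2 ^ (tW O δ n + 2) - 2) ∧
      (Prog.queries (aDist O δ Np) : ℝ) ≤
        C / δ * (Np ^ 2 * ((1 - δ) ^ (Np * G.numParts B))⁻¹ *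
          ∑ n, Real.sqrt (G.numBdryConfigs B / O.pmin n)) ∧
      ((∀ n, 1 / (Nat.card (G.IntVar n → Bool) : ℝ) ≤ O.pmin n) →
        (Prog.queries (aDist O δ Np) : ℝ) ≤
          C / δ * (Np ^ 2 * ((1 - δ) ^ (Np * G.numParts B))⁻¹ *
            ∑ n : G.Part B, Real.sqrt (G.numBdryConfigs B * Nat.card (G.IntVar n → Bool)))) ∧
      -- EPR pairs in a network where the coordinator is a neighbour of every worker
      ∀ N : SimpleGraph (Proc (G.Part B)), (∀ n, N.Adj .coord (.worker n)) →
        Prog.eprPairs N (aDist O δ Np) =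
          Np * (2 ^ (tC O δ Np + 2) - 2) * (∑ n : G.Part B, (2 * Nat.card (G.BdryVar n) + Np)) +
            Np * (2 ^ (tC O δ Np + 2) - 4) * G.numParts B +
            Np * tC O δ Np * (2 * G.numParts B) +
            (Np * tC O δ Np * (2 * G.numParts B) + Np * (2 * G.numParts B)) ∧
        (Prog.eprPairs N (aDist O δ Np) : ℝ) ≤
          C / Real.sqrt δ * (G.numParts B + Np) *
            (Np * ((1 - δ) ^ (Np * G.numParts B))⁻¹ * Fintype.card V *
              Real.sqrt (G.numBdryConfigs B)) := by
  -- One constant serves all bounds: the queries need 64 and the EPR pairs `18 * 2 = 36`.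
  refine ⟨100, by norm_num, fun V F _ _ G B O δ Np hδ hδ' hNp hG => ⟨executable_aDist,
    totalQubits_eq, qubitsAt_coord hNp, qubitsAt_coord_le hδ hδ' hNp hG, qubitsAt_worker hNp,
    queries_aDist, queries_aDist_le hδ hδ', queries_aDist_le_of_pmin hδ hδ', fun N hN =>
    ⟨eprPairs_aDist hN, eprPairs_aDist_le hδ hδ' hNp hG hN⟩⟩⟩
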